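/- Let $\Gamma$ be a finite connected graph (loops and multiple edges allowed) with edge set $E(\Gamma)$, all of whose vertices have valence greater than $2$, together with a marking $f:R_n\to\Gamma$, i.e. a homotopy equivalence from the rose with $n$ petals. Let $\Sigma_\Gamma$ be the set of functions $\ell:E(\Gamma)\to[0,1]$ with $\sum_e\ell(e)=1$ such that the edges with $\ell(e)=0$ form a forest, and let $T=\{\tau:E(\Gamma)\to\mathbb R\mid\sum_e\tau(e)=0\}$ be the tangent space $T_\ell(\Sigma_\Gamma)$ at every $\ell\in\Sigma_\Gamma$, so that $T(\Sigma_\Gamma)=\Sigma_\Gamma\times T$. A vector $\tau\in T$ is *integrable* at $\ell$ if $\tau(e)<0$ implies $\ell(e)>0$; then $\ell+t\tau\in\Sigma_\Gamma$ for small $t\ge 0$. A *loop* is a closed path in $\Gamma$ that is not null-homotopic; for $w=\ell$ or $w=\tau$, $w(\alpha)$ denotes the sum of the weights $w(e)$ over the edges crossed, with multiplicity, by the immersed loop freely homotopic to $\alpha$. A *candidate* is a loop that is an embedded circle; or a figure eight, crossing once each of two embedded circles that intersect in one point, and no other edges; or a barbell, crossing once each of two disjoint embedded circles $u,v$ and twice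 an embedded arc that joins $u$ to $v$ and has interior disjoint from $u\cup v$, and no other edges. For $\ell,\ell'\in\Sigma_\Gamma$ let $d(\ell,\ell')$ be the Lipschitz distance in Outer space between the marked metric graphs $(\Gamma,f,\ell)$ and $(\Gamma,f,\ell')$ (edges of length $0$ are collapsed): the minimum of $\log\sigma(\phi)$, where $\phi$ ranges over the maps from the first metric graph to the second that are linear on edges and satisfy $\phi f\simeq f$, and $\sigma(\phi)$ is the largest slope of $\phi$ on an edge. For $\ell\in\Sigma_\Gamma$ and $\tau\in T$ put $$\|(\ell,\tau)\|^L=\sup\left\{\frac{\tau(\alpha)}{\ell(\alpha)}\;\Big|\;\alpha\text{ is a loop in }\Gamma\right\}.$$ **Proposition.** 1. If $\tau$ is integrable at $\ell$, then $\|(\ell,\tau)\|^L=\lim_{t\to0^+}\dfrac{d(\ell,\ell+t\tau)}{t}$. 2. For all $\ell\in\Sigma_\Gamma$ and $\tau\in T$, the supremum in the definition is achieved on a candidate loop of $\Gamma$. 3. The function $(\ell,\tau)\mapsto\|(\ell,\tau)\|^L$ is continuous on $T(\Sigma_\Gamma)=\Sigma_\Gamma\times T$. 4. $\|(\ell,\tau)\|^L\ge0$,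 with equality only if $\tau=0$. 5. $\|(\ell,\tau_1+\tau_2)\|^L\le\|(\ell,\tau_1)\|^L+\|(\ell,\tau_2)\|^L$. 6. If $c>0$, then $\|(\ell,c\tau)\|^L=c\,\|(\ell,\tau)\|^L$. -/

import Mathlib

open Filter Topology

/-- A finite connected graph all of whose vertices have valence greater than two, as a
one-dimensional cell complex with vertex set `V` and set of (unoriented) edges `E`; loops and
multiple edges are allowed. Each edge carries an arbitrary reference orientation, from `init e`
to `term e` (a parametrisation of the closed 1-cell by `[0,1]`).
An oriented edge is a pair `(e, b) : E × Bool`: `(e, true)` runs from `init e` to `term e`, and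
`(e, false)` is the same edge run backwards. An edge path is a list of oriented edges, so that
the words of `FreeGroup E` (`FreeGroup.reduce`, `FreeGroup.invRev`, ...) can be used. -/
structure TopGraph (V E : Type*) where
  init : E → V
  term : E → V
  connected : ∀ u v : V, Relation.ReflTransGen
    (fun a b => ∃ e, (init e = a ∧ term e = b) ∨ (init e = b ∧ term e = a)) u v
  two_lt_valence : ∀ v : V,
    2 < Nat.card {d : E × Bool // (if d.2 then init d.1 else term d.1) = v}

/-- A piece of an edge `e`, run at constant speed from the parameter `s` to the parameter `t`. -/
structure EdgeSeg (E : Type*) where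
  edge : E
  s : unitInterval
  t : unitInterval

namespace TopGraph

variable {V E V' E' : Type*}

/-! ### Edge paths, loops, lengths -/

/-- The initial vertex of an oriented edge. -/
def src (Γ : TopGraph V E) (d : E × Bool) : V := if d.2 then Γ.init d.1 else Γ.term d.1

/-- The terminal vertex of an oriented edge. -/
def tgt (Γ : TopGraph V E) (d : E × Bool) : V := if d.2 then Γ.term d.1 else Γ.init d.1

/-- `p` is an edge path from `u` to `v`. -/
def IsPath (Γ : TopGraph V E) (u v : V) : List (E × Bool) → Prop
  | [] => u = v
  | d :: p => Γ.src d = u ∧ Γ.IsPath (Γ.tgt d) v p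

/-- A loop: a closed edge path that is not null-homotopic. (Two edge paths with the same
endpoints are homotopic if and only if their words agree in `FreeGroup E`.) -/
def IsLoop (Γ : TopGraph V E) (α : List (E × Bool)) : Prop :=
  (∃ v, Γ.IsPath v v α) ∧ FreeGroup.mk α ≠ 1

open Classical in
/-- The immersed loop freely homotopic to `α`: all backtracking is cancelled, cyclically. -/
noncomputable def tighten (α : List (E × Bool)) : List (E × Bool) :=
  FreeGroup.reduceCyclically (FreeGroup.reduce α)

/-- `w(α)`, for a metric or a tangent vector `w` and a loop `α`: the sum of the weights of the
edges crossed by the immersed loop freely homotopic to `α`, with multiplicity. -/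
noncomputable def weight (w : E → ℝ) (α : List (E × Bool)) : ℝ :=
  ((tighten α).map fun d => w d.1).sum

/-- `α` runs once around an embedded circle, starting at the vertex `x`. -/
def IsCircleAt (Γ : TopGraph V E) (x : V) (α : List (E × Bool)) : Prop :=
  α ≠ [] ∧ Γ.IsPath x x α ∧ (α.map Γ.src).Nodup ∧ (α.map Prod.fst).Nodup

/-- `α` is a figure eight based at its double point `x`. -/
def IsFigureEightAt (Γ : TopGraph V E) (x : V) (α : List (E × Bool)) : Prop :=
  ∃ u v, Γ.IsCircleAt x u ∧ Γ.IsCircleAt x v ∧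
    (∀ y, y ∈ u.map Γ.src → y ∈ v.map Γ.src → y = x) ∧
    List.Disjoint (u.map Prod.fst) (v.map Prod.fst) ∧
    α = u ++ v

/-- `α` is a barbell: it runs around the circle `u` based at `x`, then along the arc `w` from `x`
to `y`, around the circle `v` based at `y`, and back along `w`. The circles are disjoint, and `w`
is an embedded arc whose interior is disjoint from both. -/
def IsBarbellAt (Γ : TopGraph V E) (x : V) (α : List (E × Bool)) : Prop :=
  ∃ y u v w, Γ.IsCircleAt x u ∧ Γ.IsCircleAt y v ∧
    List.Disjoint (u.map Γ.src) (v.map Γ.src) ∧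
    Γ.IsPath x y w ∧ (w.map Γ.src ++ [y]).Nodup ∧
    (∀ z ∈ w.tail.map Γ.src, z ∉ u.map Γ.src ∧ z ∉ v.map Γ.src) ∧
    α = u ++ w ++ v ++ FreeGroup.invRev w

/-- Candidate loops: embedded loops, figure eights and barbells, with any starting point. -/
def IsCandidate (Γ : TopGraph V E) (α : List (E × Bool)) : Prop :=
  ∃ β x, α.IsRotated β ∧ (Γ.IsCircleAt x β ∨ Γ.IsFigureEightAt x β ∨ Γ.IsBarbellAt x β)

/-! ### The simplex of metrics and its tangent space -/

/-- The space `Σ_Γ` of metrics: edge lengths in `[0,1]` with sum `1` such that the edges of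
length zero form a forest (contain no embedded circle). -/
def metrics [Fintype E] (Γ : TopGraph V E) : Set (E → ℝ) :=
  {l | (∀ e, 0 ≤ l e ∧ l e ≤ 1) ∧ ∑ e, l e = 1 ∧
    ¬ ∃ x α, Γ.IsCircleAt x α ∧ ∀ d ∈ α, l d.1 = 0}

/-- The tangent space `T_ℓ(Σ_Γ)`, the same for all `ℓ`. -/
def tangent [Fintype E] (_Γ : TopGraph V E) : Set (E → ℝ) := {τ | ∑ e, τ e = 0}

/-- `τ` is integrable at `ℓ`. -/
def Integrable (l τ : E → ℝ) : Prop := ∀ e, τ e < 0 → 0 < l e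

/-- The set of all ratios `τ(α)/ℓ(α)`, over the loops `α` of `Γ`. -/
def ratios (Γ : TopGraph V E) (l τ : E → ℝ) : Set ℝ :=
  {r | ∃ α, Γ.IsLoop α ∧ r = weight τ α / weight l α}

/-- The norm `‖(ℓ,τ)‖^L`. -/
noncomputable def normL (Γ : TopGraph V E) (l τ : E → ℝ) : ℝ := sSup (Γ.ratios l τ)

/-! ### Points, piecewise linear paths and homotopies in the underlying space -/

/-- The points of the underlying space of `Γ`: the vertices and, for every edge, the interior
points of the edge. -/
abbrev Pt (_Γ : TopGraph V E) : Type _ := V ⊕ E × Set.Ioo (0 : ℝ) 1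

open Classical in
/-- The point of the closed edge `e` with parameter `s`. -/
noncomputable def pos (Γ : TopGraph V E) (e : E) (s : unitInterval) : Γ.Pt :=
  if h : (s : ℝ) ∈ Set.Ioo (0 : ℝ) 1 then Sum.inr (e, ⟨s, h⟩)
  else if s = 0 then Sum.inl (Γ.init e) else Sum.inl (Γ.term e)

/-- The list of edge segments `p` is a piecewise linear path from the point `a` to the
point `b`; the empty list is the constant path. -/
def IsPLPath (Γ : TopGraph V E) (a b : Γ.Pt) : List (EdgeSeg E) → Prop
  | [] => a = b
  | x :: p => Γ.pos x.edge x.s = a ∧ Γ.IsPLPath (Γ.pos x.edge x.t) b p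

/-- Elementary homotopies: deleting a constant piece, and straightening, inside one closed edge,
the path from `s` to `t` followed by the path from `t` to `u`. -/
inductive ElemHomotopy : List (EdgeSeg E) → List (EdgeSeg E) → Prop
  | const (L R : List (EdgeSeg E)) (e : E) (s : unitInterval) :
      ElemHomotopy (L ++ ⟨e, s, s⟩ :: R) (L ++ R)
  | straighten (L R : List (EdgeSeg E)) (e : E) (s t u : unitInterval) :
      ElemHomotopy (L ++ ⟨e, s, t⟩ :: ⟨e, t, u⟩ :: R) (L ++ ⟨e, s, u⟩ :: R)

/-- Homotopy relative to the endpoints, for piecewise linear paths from `a` to `b`. -/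
def Homotopic (Γ : TopGraph V E) (a b : Γ.Pt) (p q : List (EdgeSeg E)) : Prop :=
  Γ.IsPLPath a b p ∧ Γ.IsPLPath a b q ∧
    Relation.EqvGen (fun p q => Γ.IsPLPath a b p ∧ Γ.IsPLPath a b q ∧ ElemHomotopy p q) p q

/-- The path run backwards. -/
def reversePL (p : List (EdgeSeg E)) : List (EdgeSeg E) :=
  (p.map fun x => ⟨x.edge, x.t, x.s⟩).reverse

/-- An oriented edge as a piecewise linear path. -/
def dartPL (d : E × Bool) : List (EdgeSeg E) :=
  if d.2 then [⟨d.1, 0, 1⟩] else [⟨d.1, 1, 0⟩]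

/-- The length of a piecewise linear path for the edge lengths `l`. -/
noncomputable def lengthPL (l : E → ℝ) (p : List (EdgeSeg E)) : ℝ :=
  (p.map fun x => |(x.t : ℝ) - x.s| * l x.edge).sum

/-! ### Marked graphs and the Lipschitz metric -/

/-- A marking: a homotopy equivalence from the rose with `n` petals to `Γ`, given by the image of
the vertex and the edge loops that are the images of the petals. It is a homotopy equivalence if
and only if the induced map from the free group of rank `n` to the fundamental group of `Γ` at
`base` (the classes in `FreeGroup E` of the closed edge paths at `base`) is bijective. -/
structure Marking (Γ : TopGraph V E) (n : ℕ) where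
  base : V
  petal : Fin n → List (E × Bool)
  petal_isPath : ∀ i, Γ.IsPath base base (petal i)
  injective : Function.Injective (FreeGroup.lift fun i => FreeGroup.mk (petal i))
  surjective : ∀ p, Γ.IsPath base base p →
    ∃ g, FreeGroup.lift (fun i => FreeGroup.mk (petal i)) g = FreeGroup.mk p

/-- A map `Γ → Γ'` that is linear on edges: every vertex goes to a point of `Γ'`, and every edge
runs at constant speed along a piecewise linear path between the images of its ends. -/
structure LinearMap (Γ : TopGraph V E) (Γ' : TopGraph V' E') where
  vert : V → Γ'.Pt
  edge : E → List (EdgeSeg E')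
  edge_isPath : ∀ e, Γ'.IsPLPath (vert (Γ.init e)) (vert (Γ.term e)) (edge e)

/-- The image of an edge path. -/
def LinearMap.mapPath {Γ : TopGraph V E} {Γ' : TopGraph V' E'} (φ : Γ.LinearMap Γ')
    (p : List (E × Bool)) : List (EdgeSeg E') :=
  p.flatMap fun d => if d.2 then φ.edge d.1 else reversePL (φ.edge d.1)

/-- `φ` is a difference of the markings `f` and `f'`, that is, `φ ∘ f` is freely homotopic to `f'`:
`q` is the track of the vertex of the rose under the homotopy. -/
def LinearMap.IsDifference {Γ : TopGraph V E} {Γ' : TopGraph V' E'} {n : ℕ} (φ : Γ.LinearMap Γ')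
    (f : Γ.Marking n) (f' : Γ'.Marking n) : Prop :=
  ∃ q, Γ'.IsPLPath (Sum.inl f'.base) (φ.vert f.base) q ∧
    ∀ i, Γ'.Homotopic (Sum.inl f'.base) (φ.vert f.base)
      ((f'.petal i).flatMap dartPL ++ q) (q ++ φ.mapPath (f.petal i))

/-- `φ` induces a map of the metric graphs `(Γ, l) → (Γ', l')` in which the edges of length zero
are collapsed: edges of length zero have images of length zero. There is nothing to check if all
edge lengths in `Γ` are positive. -/
def LinearMap.Descends {Γ : TopGraph V E} {Γ' : TopGraph V' E'} (φ : Γ.LinearMap Γ')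
    (l : E → ℝ) (l' : E' → ℝ) : Prop :=
  ∀ e, l e = 0 → lengthPL l' (φ.edge e) = 0

/-- `σ(φ)`, the largest slope of `φ` over the edges of `Γ`. (Edges with `l e = 0` are collapsed
and have no slope; they contribute the harmless value `0`.) -/
noncomputable def LinearMap.slope {Γ : TopGraph V E} {Γ' : TopGraph V' E'} (φ : Γ.LinearMap Γ')
    (l : E → ℝ) (l' : E' → ℝ) : ℝ :=
  ⨆ e, lengthPL l' (φ.edge e) / l e

/-- The Lipschitz distance `d(x,y)` of the points `x = (Γ, f, l)` and `y = (Γ', f', l')` of Outer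
space: the least value of `log σ(φ)`, over the differences of markings `φ`. -/
noncomputable def lipDist {Γ : TopGraph V E} {Γ' : TopGraph V' E'} {n : ℕ}
    (f : Γ.Marking n) (l : E → ℝ) (f' : Γ'.Marking n) (l' : E' → ℝ) : ℝ :=
  sInf {r | ∃ φ : Γ.LinearMap Γ', φ.IsDifference f f' ∧ φ.Descends l l' ∧
    r = Real.log (φ.slope l l')}

end TopGraph

/-! Put `N = ‖(ℓ,τ)‖^L`. The weight `w = Nℓ - τ` is nonnegative on every immersed loop and zero on
at least one, and everything is read off from `w`. A loop that repeats an oriented edge splits there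
into two shorter immersed loops, so finitely many loops without repetition determine the supremum;
hence it is attained and continuous (`isGreatest_ratios`, `continuousOn_normL`).

The main tool is `exists_isPotential`: a weight that is nonnegative on loops can be distributed over
the two ends of each edge so that every turn has nonnegative weight. At a vertex at most one
direction can then be negative, and valence greater than two makes the vertex sum nonnegative, zero
only if all terms vanish. Applied to `-τ`, this gives positivity (`sum_nonneg_of_immersed`).

A loop of `w`-weight zero is one all of whose turns have weight zero. Rerouting inside such a loop
produces a circle or a barbell with the same property (`TightLoop.exists_candidate`), which is a
maximising candidate.

For small `t ≥ 0` the distance equals `log (1 + tN)` (`lipDist_eq`). For the lower bound, a map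
homotopic to the identity cannot shorten an immersed loop below its length in the target
(`LinearMap.IsDifference.le_lengthPL`). For the upper bound, push every vertex into its negative
direction `d`, if there is one, by the distance `-t p(d)`: an edge `e` then has image of length at
most `ℓ(e) + tτ(e) + t w(e) = (1 + tN)ℓ(e)` (`exists_linearMap`). Edges of length zero need extra
care, since each component of the zero forest must go to a single point. -/

namespace TopGraph

variable {V E V' E' : Type*}

/-! ### Words and edge paths -/

/-- The oriented edge `d` run backwards. -/
def rev (d : E × Bool) : E × Bool := (d.1, !d.2)

@[simp] lemma rev_rev (d : E × Bool) : rev (rev d) = d := by simp [rev]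
@[simp] lemma rev_fst (d : E × Bool) : (rev d).1 = d.1 := rfl
lemma rev_ne (d : E × Bool) : rev d ≠ d := by
  rcases d with ⟨e, b⟩; cases b <;> simp [rev]
lemma eq_or_eq_rev_of_fst_eq {d d' : E × Bool} (h : d.1 = d'.1) : d' = d ∨ d' = rev d := by
  rcases d with ⟨e, b⟩; rcases d' with ⟨e', b'⟩
  cases b <;> cases b' <;> simp_all [rev]

lemma invRev_eq (p : List (E × Bool)) : FreeGroup.invRev p = (p.map rev).reverse := rfl

section
variable (Γ : TopGraph V E)

@[simp] lemma src_rev (d : E × Bool) : Γ.src (rev d) = Γ.tgt d := by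
  rcases d with ⟨e, b⟩; cases b <;> simp [rev, src, tgt]
@[simp] lemma tgt_rev (d : E × Bool) : Γ.tgt (rev d) = Γ.src d := by
  rcases d with ⟨e, b⟩; cases b <;> simp [rev, src, tgt]

/-- `d'` may follow `d` in an immersed path. -/
def Legal (d d' : E × Bool) : Prop := Γ.tgt d = Γ.src d' ∧ d' ≠ rev d

/-- `α` is a nonempty closed edge path without backtracking, even cyclically. -/
def Immersed (α : List (E × Bool)) : Prop :=
  α ≠ [] ∧ α.IsChain Γ.Legal ∧ ∀ x ∈ α.getLast?, ∀ y ∈ α.head?, Γ.Legal x y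

variable {Γ}

lemma Legal.rev {d d' : E × Bool} (h : Γ.Legal d d') : Γ.Legal (rev d') (rev d) := by
  refine ⟨by simp [h.1], fun h' => h.2 ?_⟩
  simpa using h'.symm

lemma isPath_append {u v : V} {p q : List (E × Bool)} :
    Γ.IsPath u v (p ++ q) ↔ ∃ m, Γ.IsPath u m p ∧ Γ.IsPath m v q := by
  induction p generalizing u with
  | nil => simp [IsPath]
  | cons d p ih => simp [IsPath, ih, and_assoc]

lemma isPath_singleton {u v : V} {d : E × Bool} :
    Γ.IsPath u v [d] ↔ Γ.src d = u ∧ Γ.tgt d = v := Iff.rfl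

lemma IsPath.invRev {u v : V} {p : List (E × Bool)} (h : Γ.IsPath u v p) :
    Γ.IsPath v u (FreeGroup.invRev p) := by
  induction p generalizing u with
  | nil => exact h.symm
  | cons d p ih =>
    rw [FreeGroup.invRev_cons, isPath_append]
    exact ⟨_, ih h.2, by simp [invRev_eq, isPath_singleton, h.1]⟩

lemma IsPath.append {u v x : V} {p q : List (E × Bool)} (h : Γ.IsPath u v p)
    (h' : Γ.IsPath v x q) : Γ.IsPath u x (p ++ q) := isPath_append.2 ⟨_, h, h'⟩

lemma IsPath.src_head {u v : V} {p : List (E × Bool)} (h : Γ.IsPath u v p) :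
    ∀ y ∈ p.head?, Γ.src y = u := by
  cases p <;> simp_all [IsPath]

lemma IsPath.tgt_getLast {u v : V} {p : List (E × Bool)} (h : Γ.IsPath u v p) :
    ∀ x ∈ p.getLast?, Γ.tgt x = v := by
  induction p generalizing u with
  | nil => simp
  | cons d p ih =>
    cases p with
    | nil => simpa [IsPath] using h.2
    | cons d' p => simpa using ih h.2

lemma isPath_of_step {u v : V} {p q : List (E × Bool)} (s : FreeGroup.Red.Step p q)
    (h : Γ.IsPath u v p) : Γ.IsPath u v q := by
  cases s with
  | @not L₁ L₂ e b =>
    obtain ⟨m, h₁, h₂, h₃, h₄⟩ := isPath_append.1 h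
    refine isPath_append.2 ⟨m, h₁, ?_⟩
    have : Γ.tgt (e, !b) = Γ.src (e, b) := Γ.tgt_rev (e, b)
    rwa [this, h₂] at h₄

lemma isPath_of_red {u v : V} {p q : List (E × Bool)} (s : FreeGroup.Red p q)
    (h : Γ.IsPath u v p) : Γ.IsPath u v q := by
  induction s with
  | refl => exact h
  | tail _ s ih => exact isPath_of_step s ih

lemma not_cancel_iff {a b : E × Bool} : (a.1 = b.1 → a.2 = b.2) ↔ b ≠ rev a := by
  rcases a with ⟨e, i⟩; rcases b with ⟨e', j⟩
  cases i <;> cases j <;> simp [rev, eq_comm]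

lemma isChain_legal_iff {p : List (E × Bool)} :
    p.IsChain Γ.Legal ↔ FreeGroup.IsReduced p ∧ (p = [] ∨ ∃ u v, Γ.IsPath u v p) := by
  induction p with
  | nil => simp
  | cons d p ih =>
    cases p with
    | nil => simp [IsPath]
    | cons d' p =>
      rw [List.isChain_cons_cons, ih, FreeGroup.isReduced_cons_cons, not_cancel_iff]
      simp only [Legal, IsPath, reduceCtorEq, false_or]
      constructor
      · rintro ⟨⟨h₁, h₂⟩, h₃, _, v, _, h₅⟩
        exact ⟨⟨h₂, h₃⟩, _, v, rfl, h₁.symm, h₅⟩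
      · rintro ⟨⟨h₂, h₃⟩, _, v, _, h₁, h₅⟩
        exact ⟨⟨h₁.symm, h₂⟩, h₃, _, v, rfl, h₅⟩

lemma immersed_iff {α : List (E × Bool)} : Γ.Immersed α ↔
    α ≠ [] ∧ (∃ v, Γ.IsPath v v α) ∧ FreeGroup.IsCyclicallyReduced α := by
  constructor
  · rintro ⟨h₀, h₁, h₂⟩
    refine ⟨h₀, ?_, (isChain_legal_iff.1 h₁).1, fun a ha b hb => not_cancel_iff.2 (h₂ a ha b hb).2⟩
    obtain ⟨u, v, h⟩ := (isChain_legal_iff.1 h₁).2.resolve_left h₀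
    obtain ⟨x, hx⟩ := Option.isSome_iff_exists.1 (List.isSome_head?.2 h₀)
    obtain ⟨y, hy⟩ := Option.isSome_iff_exists.1 (List.getLast?_isSome.2 h₀)
    have := (h₂ y hy x hx).1
    rw [h.src_head x hx, h.tgt_getLast y hy] at this
    exact ⟨u, this ▸ h⟩
  · rintro ⟨h₀, ⟨v, h⟩, h₁, h₂⟩
    refine ⟨h₀, isChain_legal_iff.2 ⟨h₁, .inr ⟨_, _, h⟩⟩, fun x hx y hy => ⟨?_, ?_⟩⟩
    · rw [h.src_head y hy, h.tgt_getLast x hx]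
    · exact not_cancel_iff.1 (h₂ x hx y hy)

lemma Immersed.isLoop {α : List (E × Bool)} (h : Γ.Immersed α) : Γ.IsLoop α := by
  classical
  obtain ⟨h₀, hv, h₁⟩ := immersed_iff.1 h
  refine ⟨hv, fun h' => h₀ ?_⟩
  have := FreeGroup.reduce.sound (L₂ := []) h'
  rwa [h₁.isReduced.reduce_eq, FreeGroup.reduce_nil] at this

lemma reduceCyclically_eq_self [DecidableEq E] {α : List (E × Bool)}
    (h : FreeGroup.IsCyclicallyReduced α) : FreeGroup.reduceCyclically α = α := by
  induction α using List.bidirectionalRec with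
  | nil => simp
  | singleton a => simp
  | cons_append a l b _ =>
    rw [FreeGroup.reduceCyclically.cons_append, if_neg]
    · rfl
    · have := (FreeGroup.isCyclicallyReduced_cons_append_iff.1 h).2
      rintro ⟨h₁, h₂⟩
      have := this h₁
      cases h : b.2 <;> simp_all

lemma Immersed.tighten_eq {α : List (E × Bool)} (h : Γ.Immersed α) : tighten α = α := by
  classical
  obtain ⟨-, -, h₁⟩ := immersed_iff.1 h
  rw [tighten, h₁.isReduced.reduce_eq]
  exact @reduceCyclically_eq_self _ (Classical.decEq E) _ h₁

/-- The reduced word is `c m c⁻¹` with `m` cyclically reduced. Here `m` is nonempty because the loop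
is essential. -/
lemma IsLoop.immersed_tighten {α : List (E × Bool)} (h : Γ.IsLoop α) :
    Γ.Immersed (tighten α) := by
  classical
  obtain ⟨⟨v, hv⟩, h₁⟩ := h
  have hr : FreeGroup.IsReduced (FreeGroup.reduce α) :=
    FreeGroup.isReduced_iff_reduce_eq.2 FreeGroup.reduce.idem
  have hp := isPath_of_red (FreeGroup.reduce.red (L := α)) hv
  have hc := FreeGroup.reduceCyclically.conj_conjugator_reduceCyclically (FreeGroup.reduce α)
  set c := FreeGroup.reduceCyclically.conjugator (FreeGroup.reduce α)
  have ht : tighten α = FreeGroup.reduceCyclically (FreeGroup.reduce α) := by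
    unfold tighten; congr!
  rw [ht]
  set m := FreeGroup.reduceCyclically (FreeGroup.reduce α)
  refine immersed_iff.2 ⟨fun hm => h₁ ?_, ?_, FreeGroup.reduceCyclically.isCyclicallyReduced hr⟩
  · rw [← FreeGroup.reduce.self, ← hc, hm, List.append_nil, ← FreeGroup.mul_mk,
      ← FreeGroup.inv_mk, mul_inv_cancel]
  · rw [← hc] at hp
    obtain ⟨y, hy, h₃⟩ := isPath_append.1 hp
    obtain ⟨x, h₂, h₄⟩ := isPath_append.1 hy
    have h₅ : Γ.IsPath v y (FreeGroup.invRev (FreeGroup.invRev c)) := h₃.invRev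
    rw [FreeGroup.invRev_invRev] at h₅
    -- A path and its starting vertex determine the endpoint. Since `c` leads from `v` both to the
    -- start and to the end of `m`, the path `m` is closed.
    have key : ∀ (p : List (E × Bool)) u a b, Γ.IsPath u a p → Γ.IsPath u b p → a = b := by
      intro p
      induction p with
      | nil => intro u a b h h'; exact h.symm.trans h'
      | cons d p ih => intro u a b h h'; exact ih _ _ _ h.2 h'.2
    exact ⟨x, by rwa [← key _ _ _ _ h₂ h₅] at h₄⟩

/-- The sum of the weights of the edges of `α`, with multiplicity. -/
def pathWeight (w : E → ℝ) (α : List (E × Bool)) : ℝ := (α.map fun d => w d.1).sum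

@[simp] lemma pathWeight_nil (w : E → ℝ) : pathWeight w [] = 0 := rfl
@[simp] lemma pathWeight_cons (w : E → ℝ) (d : E × Bool) (α : List (E × Bool)) :
    pathWeight w (d :: α) = w d.1 + pathWeight w α := by simp [pathWeight]
@[simp] lemma pathWeight_append (w : E → ℝ) (α β : List (E × Bool)) :
    pathWeight w (α ++ β) = pathWeight w α + pathWeight w β := by simp [pathWeight]
lemma pathWeight_add (w w' : E → ℝ) (α : List (E × Bool)) :
    pathWeight (w + w') α = pathWeight w α + pathWeight w' α := by
  induction α with
  | nil => simp
  | cons d α ih => simp [ih]; ring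
lemma pathWeight_smul (c : ℝ) (w : E → ℝ) (α : List (E × Bool)) :
    pathWeight (c • w) α = c * pathWeight w α := by
  induction α with
  | nil => simp
  | cons d α ih => simp [ih]; ring
lemma pathWeight_nonneg {w : E → ℝ} {α : List (E × Bool)} (h : ∀ d ∈ α, 0 ≤ w d.1) :
    0 ≤ pathWeight w α :=
  List.sum_nonneg (List.forall_mem_map.2 h)

lemma weight_eq (w : E → ℝ) (α : List (E × Bool)) : weight w α = pathWeight w (tighten α) := rfl

lemma Immersed.weight_eq {α : List (E × Bool)} (h : Γ.Immersed α) (w : E → ℝ) :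
    weight w α = pathWeight w α := by rw [TopGraph.weight_eq, h.tighten_eq]

/-- Allows work with immersed loops only, where weights are plain additive sums along the word. -/
lemma ratios_eq (l τ : E → ℝ) :
    Γ.ratios l τ = {r | ∃ α, Γ.Immersed α ∧ r = pathWeight τ α / pathWeight l α} := by
  ext r
  constructor
  · rintro ⟨α, h, rfl⟩
    exact ⟨tighten α, h.immersed_tighten, rfl⟩
  · rintro ⟨α, h, rfl⟩
    exact ⟨α, h.isLoop, by rw [h.weight_eq, h.weight_eq]⟩

end

/-- A word with a repeated letter can be cut at the two occurrences. -/
lemma exists_cut_of_not_nodup {A : Type*} {α : List A} (h : ¬ α.Nodup) :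
    ∃ d X Y Z, α = X ++ d :: (Y ++ d :: Z) := by
  induction α with
  | nil => simp at h
  | cons a α ih =>
    by_cases ha : a ∈ α
    · obtain ⟨Y, Z, rfl⟩ := List.append_of_mem ha
      exact ⟨a, [], Y, Z, rfl⟩
    · obtain ⟨d, X, Y, Z, rfl⟩ := ih (fun h' => h (List.nodup_cons.2 ⟨ha, h'⟩))
      exact ⟨d, a :: X, Y, Z, rfl⟩

/-! ### Cutting, and potentials for weights that are nonnegative on all immersed loops -/

section
variable {Γ : TopGraph V E}

/-- Both occurrences of `d` have the same orientation, so cutting and regluing there creates no new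
turn. -/
lemma isChain_cut {d : E × Bool} {X Y Z : List (E × Bool)}
    (h : (X ++ d :: (Y ++ d :: Z)).IsChain Γ.Legal) :
    Γ.Immersed (d :: Y) ∧ (X ++ d :: Z).IsChain Γ.Legal := by
  have h₁ : ((d :: Y) ++ [d]).IsChain Γ.Legal := h.infix ⟨X, Z, by simp⟩
  have h₂ : (d :: Z).IsChain Γ.Legal := h.infix ⟨X ++ d :: Y, [], by simp⟩
  have h₃ : (X ++ [d]).IsChain Γ.Legal := h.infix ⟨[], Y ++ d :: Z, by simp⟩
  refine ⟨⟨by simp, (List.isChain_append.1 h₁).1, ?_⟩, ?_⟩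
  · simpa using (List.isChain_append.1 h₁).2.2
  · exact List.isChain_split.2 ⟨h₃, h₂⟩

lemma Immersed.cut {d : E × Bool} {X Y Z : List (E × Bool)}
    (h : Γ.Immersed (X ++ d :: (Y ++ d :: Z))) :
    Γ.Immersed (d :: Y) ∧ Γ.Immersed (X ++ d :: Z) := by
  obtain ⟨h₁, h₂⟩ := isChain_cut h.2.1
  refine ⟨h₁, by simp, h₂, fun x hx y hy => h.2.2 x ?_ y ?_⟩
  · rw [show X ++ d :: (Y ++ d :: Z) = (X ++ d :: Y) ++ d :: Z by simp,
      List.getLast?_append_of_ne_nil _ (by simp)]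
    rwa [List.getLast?_append_of_ne_nil _ (by simp)] at hx
  · cases X <;> simpa using hy

/-- A weight that is nonnegative on immersed loops without repeated oriented edges is
nonnegative on all immersed loops. -/
lemma pathWeight_nonneg_of_nodup {w : E → ℝ}
    (h : ∀ α, Γ.Immersed α → α.Nodup → 0 ≤ pathWeight w α) {α : List (E × Bool)}
    (hα : Γ.Immersed α) : 0 ≤ pathWeight w α := by
  induction hn : α.length using Nat.strong_induction_on generalizing α with
  | _ n ih =>
    by_cases hd : α.Nodup
    · exact h α hα hd
    · obtain ⟨d, X, Y, Z, rfl⟩ := exists_cut_of_not_nodup hd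
      obtain ⟨h₁, h₂⟩ := hα.cut
      simp only [List.length_append, List.length_cons] at hn
      have a₁ := ih _ (by simp; omega) h₁ rfl
      have a₂ := ih _ (by simp; omega) h₂ rfl
      simp at a₁ a₂ ⊢
      linarith

/-- Excising closed pieces only lowers the weight, and a path without repetition has weight at least
`-∑ |w|`. The bound makes the infima in the construction of a potential finite. -/
lemma pathWeight_bddBelow [Fintype E] {w : E → ℝ}
    (h : ∀ α, Γ.Immersed α → 0 ≤ pathWeight w α) {α : List (E × Bool)}
    (hα : α.IsChain Γ.Legal) : -∑ d : E × Bool, |w d.1| ≤ pathWeight w α := by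
  classical
  induction hn : α.length using Nat.strong_induction_on generalizing α with
  | _ n ih =>
    by_cases hd : α.Nodup
    · have h₁ : pathWeight w α = ∑ d ∈ α.toFinset, w d.1 := by
        rw [List.sum_toFinset _ hd, pathWeight]
      have h₂ : -∑ d ∈ α.toFinset, |w d.1| ≤ ∑ d ∈ α.toFinset, w d.1 := by
        rw [← Finset.sum_neg_distrib]
        exact Finset.sum_le_sum fun d _ => neg_abs_le _
      have h₃ : ∑ d ∈ α.toFinset, |w d.1| ≤ ∑ d : E × Bool, |w d.1| :=
        Finset.sum_le_sum_of_subset_of_nonneg (Finset.subset_univ _) fun _ _ _ => abs_nonneg _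
      linarith
    · obtain ⟨d, X, Y, Z, rfl⟩ := exists_cut_of_not_nodup hd
      obtain ⟨h₁, h₂⟩ := isChain_cut hα
      simp only [List.length_append, List.length_cons] at hn
      have a₁ := h _ h₁
      have a₂ := ih _ (by simp; omega) h₂ rfl
      simp at a₁ a₂ ⊢
      linarith

variable (Γ) in
/-- `p` splits the weight `w` between the two ends of every edge, so that all turns have
nonnegative weight. -/
structure IsPotential (w : E → ℝ) (p : E × Bool → ℝ) : Prop where
  edge : ∀ d, p d + p (rev d) = w d.1
  turn : ∀ d d', Γ.src d = Γ.src d' → d ≠ d' → 0 ≤ p d + p d'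

/-- A weight that is nonnegative on all immersed loops has a potential. -/
lemma exists_isPotential [Fintype E] {w : E → ℝ}
    (h : ∀ α, Γ.Immersed α → 0 ≤ pathWeight w α) : ∃ p, Γ.IsPotential w p := by
  -- `G d` is the cheapest weight of an immersed continuation after `d`, with `d` itself not
  -- counted.
  let S : E × Bool → Set ℝ := fun d => {r | ∃ γ, (d :: γ).IsChain Γ.Legal ∧ r = pathWeight w γ}
  let G : E × Bool → ℝ := fun d => sInf (S d)
  have hb : ∀ d, BddBelow (S d) := fun d => by
    refine ⟨-∑ d : E × Bool, |w d.1|, ?_⟩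
    rintro r ⟨γ, hγ, rfl⟩
    exact pathWeight_bddBelow h (List.isChain_of_isChain_cons hγ)
  have hne : ∀ d, (S d).Nonempty := fun d => ⟨0, [], by simp, by simp⟩
  -- If `d` and `d'` leave the same vertex and differ, then `d` followed by any continuation may
  -- follow `rev d'`.
  have key : ∀ d d', Γ.src d = Γ.src d' → d ≠ d' → G (rev d') ≤ w d.1 + G d := by
    intro d d' hs hd
    suffices G (rev d') - w d.1 ≤ G d by linarith
    refine le_csInf (hne d) ?_
    rintro r ⟨γ, hγ, rfl⟩
    have : G (rev d') ≤ pathWeight w (d :: γ) := csInf_le (hb _)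
      ⟨d :: γ, List.isChain_cons_cons.2 ⟨⟨by simp [hs], by simpa using hd⟩, hγ⟩, rfl⟩
    simp at this
    linarith
  -- Antisymmetrising in `G` makes the two ends of an edge add up to `w`. The weight of a turn `{d,
  -- d'}` is half the sum of the slacks in `key d d'` and `key d' d`.
  refine ⟨fun d => (w d.1 + G d - G (rev d)) / 2, ⟨fun d => ?_, fun d d' hs hd => ?_⟩⟩
  · simp only [rev_rev, rev_fst]; ring
  · have h₁ := key d d' hs hd
    have h₂ := key d' d hs.symm hd.symm
    linarith

/-! ### Summing a potential over the vertices -/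

section
variable {w : E → ℝ} {p : E × Bool → ℝ}

open Classical in
lemma sum_src_eq [Finite V] [Fintype E] (f : E × Bool → ℝ) :
    ∃ _ : Fintype V, ∑ d, f d = ∑ v, ∑ d with Γ.src d = v, f d := by
  have := Fintype.ofFinite V
  exact ⟨this, (Finset.sum_fiberwise _ _ _).symm⟩

open Classical in
lemma two_lt_card [Fintype E] (Γ : TopGraph V E) (v : V) :
    2 < (Finset.univ.filter fun d => Γ.src d = v).card := by
  have := Γ.two_lt_valence v
  rwa [Nat.card_eq_fintype_card, Fintype.card_subtype] at this

lemma exists_src_eq [Fintype E] (Γ : TopGraph V E) (v : V) : ∃ d, Γ.src d = v := by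
  classical
  have h := Γ.two_lt_card v
  obtain ⟨d, hd⟩ := Finset.card_pos.1 (by omega : 0 < (Finset.univ.filter
    fun d => Γ.src d = v).card)
  exact ⟨d, by simpa using hd⟩

/-- The potentials of the directions at a vertex have nonnegative sum, and vanish if the sum
does. -/
lemma IsPotential.vertex_sum [Fintype E] [DecidableEq V] (hp : Γ.IsPotential w p) (v : V) :
    0 ≤ ∑ d with Γ.src d = v, p d ∧
      (∑ d with Γ.src d = v, p d = 0 → ∀ d, Γ.src d = v → p d = 0) := by
  classical
  set s := Finset.univ.filter fun d => Γ.src d = v with hs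
  have hc : 2 < s.card := by convert Γ.two_lt_card v
  have mem : ∀ d, d ∈ s ↔ Γ.src d = v := by simp [hs]
  have hpair : ∀ d ∈ s, ∀ d' ∈ s, d ≠ d' → 0 ≤ p d + p d' := fun d hd d' hd' =>
    hp.turn d d' (by rw [(mem d).1 hd, (mem d').1 hd'])
  by_cases hneg : ∃ d ∈ s, p d < 0
  · obtain ⟨d, hd, hd0⟩ := hneg
    -- Every other direction has potential at least `-p d > 0`, and there are at least two of them,
    -- so the sum is at least `-p d`. With valence two, `p` and `-p` could cancel.
    have h₁ : (s.erase d).card • (-p d) ≤ ∑ d' ∈ s.erase d, p d' :=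
      Finset.card_nsmul_le_sum _ _ _ fun d' hd' => by
        have := hpair d hd d' (Finset.mem_of_mem_erase hd') (Finset.ne_of_mem_erase hd').symm
        linarith
    have h₂ : (2 : ℝ) ≤ (s.erase d).card := by
      rw [Finset.card_erase_of_mem hd]
      exact_mod_cast (by omega : 2 ≤ s.card - 1)
    rw [nsmul_eq_mul] at h₁
    have h₃ := Finset.add_sum_erase s p hd
    have h₄ : 0 < ∑ d ∈ s, p d := by nlinarith
    exact ⟨h₄.le, fun h => absurd h h₄.ne'⟩
  · push Not at hneg
    exact ⟨Finset.sum_nonneg hneg, fun h d hd =>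
      (Finset.sum_eq_zero_iff_of_nonneg hneg).1 h d ((mem d).2 hd)⟩

lemma sum_dart_eq [Fintype E] (hp : Γ.IsPotential w p) : ∑ d, p d = ∑ e, w e := by
  rw [Fintype.sum_prod_type]
  refine Finset.sum_congr rfl fun e _ => ?_
  have := hp.edge (e, true)
  simpa [rev] using this

/-- A weight with nonnegative loops has nonnegative total, and vanishes if the total does. -/
lemma sum_nonneg_of_immersed [Finite V] [Fintype E]
    (h : ∀ α, Γ.Immersed α → 0 ≤ pathWeight w α) :
    0 ≤ ∑ e, w e ∧ (∑ e, w e = 0 → w = 0) := by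
  classical
  obtain ⟨p, hp⟩ := exists_isPotential h
  obtain ⟨_, hV⟩ := sum_src_eq (Γ := Γ) p
  rw [← sum_dart_eq hp, hV]
  have hv := fun v => hp.vertex_sum v
  have hn : ∀ v ∈ Finset.univ, 0 ≤ ∑ d with Γ.src d = v, p d := fun v _ => (hv v).1
  refine ⟨Finset.sum_nonneg hn, fun h0 => ?_⟩
  have h1 := (Finset.sum_eq_zero_iff_of_nonneg hn).1 h0
  have h2 : ∀ d, p d = 0 := fun d => (hv _).2 (h1 (Γ.src d) (Finset.mem_univ _)) d rfl
  funext e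
  have := hp.edge (e, true)
  simpa [h2] using this.symm

/-- Without such loops the constant weight `-1` would vacuously be nonnegative on loops, although
its total is negative. -/
lemma exists_immersed [Finite V] [Fintype E] [Nonempty E] (Γ : TopGraph V E) :
    ∃ α, Γ.Immersed α ∧ α.Nodup := by
  by_contra! hα
  have h₁ : ∀ α, Γ.Immersed α → 0 ≤ pathWeight (fun _ => -1) α := fun α h =>
    pathWeight_nonneg_of_nodup (fun α h h' => absurd h' (hα α h)) h
  have h₂ := (sum_nonneg_of_immersed h₁).1
  simp at h₂

end
end

/-! ### Tight turns and the existence of tight candidates -/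

section
variable {Γ : TopGraph V E} {w : E → ℝ} {p : E × Bool → ℝ}

variable (Γ p) in
/-- The turn `{d, d'}` has weight zero. -/
def Tight (d d' : E × Bool) : Prop := Γ.src d = Γ.src d' ∧ d ≠ d' ∧ p d + p d' = 0

variable (Γ p) in
/-- `d'` follows `d` through a tight turn. -/
def TightFollow (d d' : E × Bool) : Prop := Γ.Tight p (rev d) d'

variable (Γ p) in
/-- A nonempty closed path all of whose turns are tight. -/
def TightLoop (α : List (E × Bool)) : Prop :=
  α ≠ [] ∧ α.IsChain (Γ.TightFollow p) ∧ ∀ x ∈ α.getLast?, ∀ y ∈ α.head?, Γ.TightFollow p x y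

lemma Tight.symm {d d' : E × Bool} (h : Γ.Tight p d d') : Γ.Tight p d' d :=
  ⟨h.1.symm, h.2.1.symm, by linarith [h.2.2]⟩

lemma TightFollow.legal {d d' : E × Bool} (h : Γ.TightFollow p d d') : Γ.Legal d d' :=
  ⟨by simpa using h.1, h.2.1.symm⟩

lemma TightFollow.rev {d d' : E × Bool} (h : Γ.TightFollow p d d') :
    Γ.TightFollow p (rev d') (rev d) := by
  unfold TightFollow
  rw [rev_rev]
  exact Tight.symm h

lemma isChain_legal {α : List (E × Bool)} (h : α.IsChain (Γ.TightFollow p)) :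
    α.IsChain Γ.Legal := h.imp fun _ _ => TightFollow.legal

lemma TightLoop.immersed {α : List (E × Bool)} (h : Γ.TightLoop p α) : Γ.Immersed α :=
  ⟨h.1, isChain_legal h.2.1, fun x hx y hy => (h.2.2 x hx y hy).legal⟩

lemma isChain_invRev {α : List (E × Bool)} (h : α.IsChain (Γ.TightFollow p)) :
    (FreeGroup.invRev α).IsChain (Γ.TightFollow p) := by
  rw [invRev_eq, List.isChain_reverse, List.isChain_map]
  exact h.imp fun _ _ => TightFollow.rev

/-- Splitting each edge into its two ends, the contributions at each interior turn cancel and only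
the two extreme ends remain. -/
lemma pathWeight_eq_of_tight (hp : Γ.IsPotential w p) {d : E × Bool} {α : List (E × Bool)}
    (h : (d :: α).IsChain (Γ.TightFollow p)) :
    ∀ x ∈ (d :: α).getLast?, pathWeight w (d :: α) = p d + p (rev x) := by
  induction α generalizing d with
  | nil => simp [hp.edge]
  | cons d' α ih =>
    rw [List.isChain_cons_cons] at h
    intro x hx
    have h₁ := ih h.2 x (by simpa using hx)
    have h₂ := h.1.2.2
    rw [pathWeight_cons, h₁, ← hp.edge]
    linarith

lemma TightLoop.pathWeight_eq_zero (hp : Γ.IsPotential w p) {α : List (E × Bool)}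
    (h : Γ.TightLoop p α) : pathWeight w α = 0 := by
  obtain ⟨h₀, h₁, h₂⟩ := h
  cases α with
  | nil => simp
  | cons d α =>
    obtain ⟨x, hx⟩ := Option.isSome_iff_exists.1 (List.getLast?_isSome.2 h₀)
    rw [pathWeight_eq_of_tight hp h₁ x hx]
    have := (h₂ x hx d (by simp)).2.2
    linarith

/-- The same regrouping by turns: interior turns contribute nonnegative amounts, so equality forces
each of them to be tight. -/
lemma le_pathWeight (hp : Γ.IsPotential w p) {d : E × Bool} {α : List (E × Bool)}
    (h : (d :: α).IsChain Γ.Legal) :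
    ∀ x ∈ (d :: α).getLast?, p d + p (rev x) ≤ pathWeight w (d :: α) ∧
      (pathWeight w (d :: α) ≤ p d + p (rev x) → (d :: α).IsChain (Γ.TightFollow p)) := by
  induction α generalizing d with
  | nil => simp [hp.edge]
  | cons d' α ih =>
    rw [List.isChain_cons_cons] at h
    intro x hx
    have h₁ := ih h.2 x (by simpa using hx)
    have h₂ := hp.turn (rev d) d' (by simpa using h.1.1) h.1.2.symm
    rw [pathWeight_cons, ← hp.edge]
    refine ⟨by linarith, fun h₃ => List.isChain_cons_cons.2 ⟨⟨by simpa using h.1.1, h.1.2.symm, ?_⟩,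
      h₁.2 (by linarith)⟩⟩
    linarith

lemma Immersed.tightLoop (hp : Γ.IsPotential w p) {α : List (E × Bool)} (h : Γ.Immersed α)
    (h0 : pathWeight w α ≤ 0) : Γ.TightLoop p α := by
  obtain ⟨h₀, h₁, h₂⟩ := h
  cases α with
  | nil => simp at h₀
  | cons d α =>
    obtain ⟨x, hx⟩ := Option.isSome_iff_exists.1 (List.getLast?_isSome.2 h₀)
    have h₃ := le_pathWeight hp h₁ x hx
    have h₄ := h₂ x hx d (by simp)
    have h₅ := hp.turn (rev x) d (by simpa using h₄.1) h₄.2.symm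
    refine ⟨h₀, h₃.2 (by linarith), fun x' hx' y hy => ?_⟩
    obtain rfl : x = x' := by simpa [hx] using hx'
    obtain rfl : d = y := by simpa using hy
    exact ⟨by simpa using h₄.1, h₄.2.symm, by linarith⟩

lemma isPath_of_isChain {d : E × Bool} {q : List (E × Bool)} (h : (d :: q).IsChain Γ.Legal) :
    ∀ x ∈ (d :: q).getLast?, Γ.IsPath (Γ.src d) (Γ.tgt x) (d :: q) := by
  induction q generalizing d with
  | nil => simp [IsPath]
  | cons d' q ih =>
    rw [List.isChain_cons_cons] at h
    intro x hx
    exact ⟨rfl, by rw [h.1.1]; exact ih h.2 x (by simpa using hx)⟩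

/-- A closed path without backtracking and with distinct vertices is a circle. -/
lemma isCircleAt_of_nodup {d : E × Bool} {q : List (E × Bool)} (h : (d :: q).IsChain Γ.Legal)
    {x : E × Bool} (hx : x ∈ (d :: q).getLast?) (hd : Γ.tgt x = Γ.src d)
    (hn : ((d :: q).map Γ.src).Nodup) : Γ.IsCircleAt (Γ.src d) (d :: q) := by
  have hp := isPath_of_isChain h x hx
  rw [hd] at hp
  refine ⟨by simp, hp, hn, List.Nodup.map_on ?_ hn.of_map⟩
  have inj : ∀ a ∈ d :: q, ∀ b ∈ d :: q, Γ.src a = Γ.src b → a = b :=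
    fun a ha b hb => List.inj_on_of_nodup_map hn ha hb
  -- If `a` had a successor, it would start where `rev a` starts, hence equal `rev a`: a backtrack.
  -- Applied to both `a` and `rev a`, this makes them the same last edge.
  have next : ∀ a ∈ d :: q, rev a ∈ d :: q → a = x := by
    intro a ha ha'
    obtain ⟨X, Y, hXY⟩ := List.append_of_mem ha
    cases Y with
    | nil => rw [hXY] at hx; simpa using hx
    | cons b Y =>
      have h₁ : Γ.Legal a b := by
        rw [hXY] at h
        exact (List.isChain_append_cons_cons.1 h).2.1
      exact absurd (inj b (by rw [hXY]; simp) _ ha' (by simp [h₁.1])) h₁.2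
  intro a ha b hb hab
  rcases eq_or_eq_rev_of_fst_eq hab with rfl | rfl
  · rfl
  · have h₁ := next a ha hb
    have h₂ := next (rev a) hb (by simpa using ha)
    exact h₁.trans h₂.symm

/-- An oriented edge and its reverse do not both occur in a circle. -/
lemma IsCircleAt.rev_notMem {v : V} {u : List (E × Bool)} (h : Γ.IsCircleAt v u) {a : E × Bool}
    (ha : a ∈ u) : rev a ∉ u := fun h' =>
  rev_ne a (List.inj_on_of_nodup_map h.2.2.2 h' ha rfl)

/-- Follow a relation from `d₀` until the path meets `S` or itself. -/
lemma exists_walk [Finite V] {R : E × Bool → E × Bool → Prop} {D : Set (E × Bool)}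
    (hR : ∀ d ∈ D, ∃ d' ∈ D, R d d') (hl : ∀ d d', R d d' → Γ.tgt d = Γ.src d')
    (S : Set V) {d₀ : E × Bool} (h₀ : d₀ ∈ D) :
    ∃ q x, (d₀ :: q).IsChain R ∧ (∀ d ∈ d₀ :: q, d ∈ D) ∧ ((d₀ :: q).map Γ.src).Nodup ∧
      (∀ d ∈ q, Γ.src d ∉ S) ∧ x ∈ (d₀ :: q).getLast? ∧
      (Γ.tgt x ∈ S ∨ Γ.tgt x ∈ (d₀ :: q).map Γ.src) := by
  by_contra hcon
  have := Fintype.ofFinite V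
  -- A walk that never stops has distinct sources at every length, which exceeds the number of
  -- vertices.
  have key : ∀ n : ℕ, ∃ q, q.length = n ∧ (d₀ :: q).IsChain R ∧ (∀ d ∈ d₀ :: q, d ∈ D) ∧
      ((d₀ :: q).map Γ.src).Nodup ∧ (∀ d ∈ q, Γ.src d ∉ S) := by
    intro n
    induction n with
    | zero => exact ⟨[], rfl, by simp, by simpa using h₀, by simp, by simp⟩
    | succ n ih =>
      obtain ⟨q, hn, h₁, h₂, h₃, h₄⟩ := ih
      obtain ⟨x, hx⟩ := Option.isSome_iff_exists.1
        (List.getLast?_isSome.2 (List.cons_ne_nil d₀ q))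
      have h₅ : ¬ (Γ.tgt x ∈ S ∨ Γ.tgt x ∈ (d₀ :: q).map Γ.src) := fun h =>
        hcon ⟨q, x, h₁, h₂, h₃, h₄, hx, h⟩
      push Not at h₅
      obtain ⟨y, hy, hxy⟩ := hR x (h₂ x (List.mem_of_getLast? hx))
      refine ⟨q ++ [y], by simp [hn], ?_, ?_, ?_, ?_⟩
      · rw [← List.cons_append, List.isChain_append]
        refine ⟨h₁, by simp, fun x' hx' y' hy' => ?_⟩
        obtain rfl : x = x' := by simpa [hx] using hx'
        obtain rfl : y = y' := by simpa using hy'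
        exact hxy
      · intro d hd
        rw [← List.cons_append, List.mem_append, List.mem_singleton] at hd
        rcases hd with hd | rfl
        exacts [h₂ d hd, hy]
      · rw [← List.cons_append, List.map_append, List.nodup_append]
        refine ⟨h₃, by simp, ?_⟩
        rintro a ha b hb rfl
        simp only [List.map_cons, List.map_nil, List.mem_singleton] at hb
        exact h₅.2 (by rw [hl _ _ hxy, ← hb]; exact ha)
      · intro d hd
        rcases List.mem_append.1 hd with hd | hd
        · exact h₄ d hd
        · rw [List.mem_singleton.1 hd, ← hl _ _ hxy]; exact h₅.1
  obtain ⟨q, hn, -, -, h₃, -⟩ := key (Fintype.card V)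
  have := h₃.length_le_card
  simp at this
  omega

/-- The end of a walk that meets itself is a circle. -/
lemma isCircleAt_of_walk {P u : List (E × Bool)} {b x : E × Bool}
    (h : (P ++ b :: u).IsChain Γ.Legal) (hx : x ∈ (P ++ b :: u).getLast?)
    (hb : Γ.src b = Γ.tgt x) (hn : ((P ++ b :: u).map Γ.src).Nodup) :
    x ∈ (b :: u).getLast? ∧ Γ.IsCircleAt (Γ.src b) (b :: u) := by
  have hx' : x ∈ (b :: u).getLast? := by
    rwa [List.getLast?_append_of_ne_nil _ (by simp)] at hx
  rw [List.map_append, List.nodup_append] at hn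
  exact ⟨hx', isCircleAt_of_nodup (List.isChain_append.1 h).2.1 hx' hb.symm hn.2.1⟩

/-- Every immersed loop contains a circle. -/
lemma Immersed.exists_circle [Finite V] {α : List (E × Bool)} (h : Γ.Immersed α) :
    ∃ v u, Γ.IsCircleAt v u ∧ ∀ d ∈ u, d ∈ α := by
  obtain ⟨h₀, h₁, h₂⟩ := h
  obtain ⟨d₀, hd₀⟩ := List.exists_mem_of_ne_nil α h₀
  obtain ⟨q, x, a₁, a₂, a₃, -, a₅, a₆⟩ := exists_walk (Γ := Γ) (R := Γ.Legal) (D := {d | d ∈ α})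
    (fun d hd => by
      obtain ⟨X, Y, rfl⟩ := List.append_of_mem hd
      cases Y with
      | nil =>
        obtain ⟨y, hy⟩ := Option.isSome_iff_exists.1 (List.isSome_head?.2 h₀)
        exact ⟨y, List.mem_of_head? hy, h₂ d (by simp) y hy⟩
      | cons b Y => exact ⟨b, by simp, (List.isChain_append_cons_cons.1 h₁).2.1⟩)
    (fun d d' h => h.1) ∅ hd₀
  obtain ⟨b, hb, hbx⟩ := List.mem_map.1 (a₆.resolve_left (by simp))
  obtain ⟨P, u, hP⟩ := List.append_of_mem hb
  rw [hP] at a₁ a₂ a₃ a₅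
  exact ⟨_, _, (isCircleAt_of_walk a₁ a₅ hbx a₃).2, fun d hd => a₂ d (by simp at hd ⊢; tauto)⟩

/-- Outside the degenerate cases, `p a = -p b` and `p x = -p c`. Nonnegativity of the turns `{a, c}`
and `{x, b}` forces `p b = p c`, so `{a, c}` is tight. A path arriving against a direction that lies
in some tight turn can thus merge into any other tight turn at that vertex. -/
lemma Tight.trichotomy (hp : Γ.IsPotential w p) {a b c x : E × Bool} (h : Γ.Tight p b a)
    (h' : Γ.Tight p c x) (hs : Γ.src b = Γ.src c) :
    Γ.Tight p b c ∨ Γ.Tight p a c := by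
  by_cases hac : a = c
  · exact .inl (hac ▸ h)
  by_cases hxb : x = b
  · exact .inl (hxb ▸ h'.symm)
  have h₁ := hp.turn a c (h.1.symm.trans hs) hac
  have h₂ := hp.turn x b (h'.1.symm.trans hs.symm) hxb
  exact .inr ⟨h.1.symm.trans hs, hac, by linarith [h.2.2, h'.2.2]⟩

/-- Here `p b = p c = -p x` and `p b + p c > 0`, so `p x < 0`. If neither `d` nor `y` were `x`,
adding the turns `{d, x}` and `{y, x}` would give `2 p x ≥ 0`. So every tight turn at this vertex
involves `x`. -/
lemma Tight.of_not_tight (hp : Γ.IsPotential w p) {x b c d y : E × Bool} (h : Γ.Tight p x b)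
    (h' : Γ.Tight p x c) (hbc : b ≠ c) (hn : ¬ Γ.Tight p b c) (hd : Γ.Tight p d y)
    (hs : Γ.src d = Γ.src x) (hdx : d ≠ x) : Γ.Tight p d x := by
  by_cases hyx : y = x
  · exact hyx ▸ hd
  have hbc' : Γ.src b = Γ.src c := h.1.symm.trans h'.1
  have h₁ := hp.turn b c hbc' hbc
  have h₂ : p b + p c ≠ 0 := fun h0 => hn ⟨hbc', hbc, h0⟩
  have h₃ := hp.turn d x hs hdx
  have h₄ := hp.turn y x (hd.1.symm.trans hs) hyx
  have := lt_of_le_of_ne h₁ h₂.symm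
  linarith [h.2.2, h'.2.2, hd.2.2]

lemma TightLoop.of_cons {d : E × Bool} {q : List (E × Bool)}
    (h : (d :: q).IsChain (Γ.TightFollow p)) {x : E × Bool} (hx : x ∈ (d :: q).getLast?)
    (hd : Γ.Tight p (rev x) d) : Γ.TightLoop p (d :: q) := by
  refine ⟨by simp, h, fun x' hx' y hy => ?_⟩
  obtain rfl : x = x' := by simpa only [Option.mem_def.1 hx, Option.mem_def,
    Option.some.injEq] using hx'
  obtain rfl : d = y := by simpa using hy
  exact hd

end

/-! ### Extracting a tight circle or barbell from a tight loop -/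

section
variable {Γ : TopGraph V E} {w : E → ℝ} {p : E × Bool → ℝ}

lemma getLast?_invRev_cons (d : E × Bool) (q : List (E × Bool)) :
    (FreeGroup.invRev (d :: q)).getLast? = some (rev d) := by
  simp [invRev_eq]

lemma map_src_invRev (q : List (E × Bool)) :
    (FreeGroup.invRev q).map Γ.src = (q.map Γ.tgt).reverse := by
  simp [invRev_eq, Function.comp_def]

lemma map_tgt_eq {q : List (E × Bool)} {d m : E × Bool}
    (h : (d :: q ++ [m]).IsChain Γ.Legal) :
    (d :: q).map Γ.tgt = q.map Γ.src ++ [Γ.src m] := by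
  induction q generalizing d with
  | nil =>
    have : Γ.tgt d = Γ.src m := (List.isChain_pair.1 h).1
    simpa
  | cons d' q ih =>
    simp only [List.cons_append, List.isChain_cons_cons] at h
    have := ih h.2
    simp only [List.map_cons] at this ⊢
    rw [this, h.1.1]
    rfl

/-- The walk `Q` leaves the circle `u` at its base point and returns to another vertex of it. -/
lemma exists_tight_circle_of_theta (hp : Γ.IsPotential w p)
    {b k m x y n : E × Bool} {u₁ u₂ q : List (E × Bool)} {v : V}
    (hu : Γ.IsCircleAt v (b :: u₁ ++ m :: u₂))
    (hut : (b :: u₁ ++ m :: u₂).IsChain (Γ.TightFollow p))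
    (hk : k ∈ (b :: u₁).getLast?)
    (hbx : Γ.Tight p x b) (hcx : ∀ c ∈ (m :: u₂).getLast?, Γ.Tight p x (rev c))
    (hq : (x :: q).IsChain (Γ.TightFollow p)) (hqn : ((x :: q).map Γ.src).Nodup)
    (hqu : ∀ d ∈ q, Γ.src d ∉ (b :: u₁ ++ m :: u₂).map Γ.src)
    (hy : y ∈ (x :: q).getLast?) (hym : Γ.tgt y = Γ.src m) (hn : Γ.Tight p (rev y) n) :
    ∃ z β, Γ.TightLoop p β ∧ Γ.IsCircleAt z β := by
  have hvb : Γ.src b = v := hu.2.1.1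
  have hvx : Γ.src x = v := hbx.1.trans hvb
  have hkm : Γ.Tight p (rev k) m := (List.isChain_append.1 hut).2.2 k hk m (by simp)
  have hnod : ((b :: u₁ ++ m :: u₂).map Γ.src).Nodup := hu.2.2.1
  rw [List.map_append, List.nodup_append] at hnod
  -- The walk arrives at an interior point of a tight turn of the circle, so it can continue
  -- smoothly along one of the two arcs. At the base both arcs join `x` through a tight turn.
  rcases hkm.trichotomy hp hn (by rw [hkm.1, src_rev, hym]) with h | h
  · -- close up along `u₁` backwards
    have hch : ((x :: q) ++ FreeGroup.invRev (b :: u₁)).IsChain (Γ.TightFollow p) := by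
      rw [List.isChain_append]
      refine ⟨hq, isChain_invRev (List.isChain_append.1 hut).1, fun y' hy' a ha => ?_⟩
      obtain rfl : y = y' := by simpa only [Option.mem_def.1 hy, Option.mem_def,
        Option.some.injEq] using hy'
      have : a = rev k := by
        rw [invRev_eq, List.head?_reverse, List.getLast?_map, Option.mem_def.1 hk] at ha
        simpa using ha.symm
      exact this ▸ h.symm
    have hlast : rev b ∈ ((x :: q) ++ FreeGroup.invRev (b :: u₁)).getLast? := by
      rw [List.getLast?_append_of_ne_nil _ (by simp [invRev_eq]), getLast?_invRev_cons]; simp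
    refine ⟨_, _, TightLoop.of_cons hch hlast (by simpa using hbx.symm),
      isCircleAt_of_nodup (isChain_legal hch) hlast (by simp [hvb, hvx]) ?_⟩
    have hsplit : (b :: u₁ ++ [m]).IsChain Γ.Legal :=
      (isChain_legal hut).infix ⟨[], u₂, by simp⟩
    change (((x :: q) ++ _).map Γ.src).Nodup
    rw [List.map_append, map_src_invRev, map_tgt_eq hsplit, List.nodup_append]
    refine ⟨hqn, ?_, ?_⟩
    · rw [List.nodup_reverse, List.nodup_append]
      refine ⟨(List.nodup_cons.1 hnod.1).2, by simp, ?_⟩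
      intro a ha a' ha'
      rw [List.mem_singleton.1 ha']
      exact hnod.2.2 a (List.mem_cons_of_mem _ ha) _ (by simp)
    · rintro a ha a' ha' rfl
      have ha₁ : a ∈ (b :: u₁ ++ m :: u₂).map Γ.src ∧ a ≠ v := by
        rw [List.mem_reverse, List.mem_append, List.mem_singleton] at ha'
        rcases ha' with h' | rfl
        · refine ⟨?_, fun hav => ?_⟩
          · rw [List.map_append]
            exact List.mem_append_left _ (List.mem_cons_of_mem _ h')
          exact (List.nodup_cons.1 hnod.1).1 (by rw [hvb, ← hav]; exact h')
        · exact ⟨by simp, fun hav => hnod.2.2 (Γ.src b) (by simp) (Γ.src m) (by simp)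
            (by rw [hvb, hav])⟩
      obtain ⟨d, hd, rfl⟩ := List.mem_map.1 ha
      rcases List.mem_cons.1 hd with rfl | hd
      · exact ha₁.2 hvx
      · exact hqu d hd ha₁.1
  · -- close up along `m :: u₂`
    have hch : ((x :: q) ++ m :: u₂).IsChain (Γ.TightFollow p) := by
      rw [List.isChain_append]
      refine ⟨hq, (List.isChain_append.1 hut).2.1, fun y' hy' a ha => ?_⟩
      obtain rfl : y = y' := by simpa only [Option.mem_def.1 hy, Option.mem_def,
        Option.some.injEq] using hy'
      obtain rfl : m = a := by simpa using ha
      exact h.symm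
    obtain ⟨c, hc⟩ := Option.isSome_iff_exists.1
      (List.getLast?_isSome.2 (List.cons_ne_nil m u₂))
    have hlast : c ∈ ((x :: q) ++ m :: u₂).getLast? := by
      rwa [List.getLast?_append_of_ne_nil _ (by simp)]
    refine ⟨_, _, TightLoop.of_cons hch hlast (hcx c hc).symm,
      isCircleAt_of_nodup (isChain_legal hch) hlast (by simpa using (hcx c hc).1.symm) ?_⟩
    change (((x :: q) ++ _).map Γ.src).Nodup
    rw [List.map_append, List.nodup_append]
    refine ⟨hqn, hnod.2.1, ?_⟩
    rintro a ha a' ha' rfl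
    obtain ⟨d, hd, rfl⟩ := List.mem_map.1 ha
    rcases List.mem_cons.1 hd with rfl | hd
    · exact hnod.2.2 (Γ.src b) (by simp) _ ha' (by rw [hvb, hvx])
    · exact hqu d hd (by rw [List.map_append]; exact List.mem_append_right _ ha')

/-- If there is a tight loop, then there is a tight circle or a tight barbell. -/
lemma TightLoop.exists_candidate [Finite V] (hp : Γ.IsPotential w p) {α : List (E × Bool)}
    (h : Γ.TightLoop p α) :
    ∃ z β, Γ.TightLoop p β ∧ (Γ.IsCircleAt z β ∨ Γ.IsBarbellAt z β) := by
  obtain ⟨h₀, h₁, h₂⟩ := h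
  -- All walks stay among the oriented edges of `α`, where tight continuations always exist.
  set D : Set (E × Bool) := {d | d ∈ α} with hD
  have next : ∀ d ∈ D, ∃ d' ∈ D, Γ.TightFollow p d d' := fun d hd => by
    obtain ⟨X, Y, rfl⟩ := List.append_of_mem hd
    cases Y with
    | nil =>
      obtain ⟨y, hy⟩ := Option.isSome_iff_exists.1 (List.isSome_head?.2 h₀)
      exact ⟨y, List.mem_of_head? hy, h₂ d (by simp) y hy⟩
    | cons b Y => exact ⟨b, by simp [hD], (List.isChain_append_cons_cons.1 h₁).2.1⟩
  have prev : ∀ d ∈ D, ∃ a, Γ.Tight p d a := fun d hd => by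
    obtain ⟨X, Y, rfl⟩ := List.append_of_mem hd
    rcases List.eq_nil_or_concat X with rfl | ⟨X, b, rfl⟩
    · obtain ⟨y, hy⟩ := Option.isSome_iff_exists.1 (List.getLast?_isSome.2 h₀)
      exact ⟨_, (h₂ y hy d (by simp)).symm⟩
    · rw [List.concat_eq_append, List.append_assoc, List.singleton_append] at h₁
      exact ⟨_, (List.isChain_append_cons_cons.1 h₁).2.1.symm⟩
  have hl : ∀ d d', Γ.TightFollow p d d' → Γ.tgt d = Γ.src d' := fun d d' h => h.legal.1
  obtain ⟨d₀, hd₀⟩ := List.exists_mem_of_ne_nil α h₀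
  obtain ⟨q₀, c, a₁, a₂, a₃, -, a₅, a₆⟩ := exists_walk next hl ∅ hd₀
  obtain ⟨b, hb, hbc⟩ := List.mem_map.1 (a₆.resolve_left (by simp))
  obtain ⟨P, u, hP⟩ := List.append_of_mem hb
  rw [hP] at a₁ a₂ a₃ a₅
  obtain ⟨hc, hu⟩ := isCircleAt_of_walk (isChain_legal a₁) a₅ hbc a₃
  have hut := (List.isChain_append.1 a₁).2.1
  have hbD : b ∈ D := a₂ b (by simp)
  have hcD : c ∈ D := a₂ c (List.mem_of_getLast? a₅)
  clear a₁ a₂ a₃ a₅ a₆ hP hb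
  by_cases hcb : Γ.Tight p (rev c) b
  · exact ⟨_, _, TightLoop.of_cons hut hc hcb, .inl hu⟩
  obtain ⟨x, hxD, hcx⟩ := next c hcD
  obtain ⟨a, hba⟩ := prev b hbD
  -- The circle fails to be tight only at its base point. There the exit `x` makes a tight turn with
  -- both ends of the circle.
  have hxb : Γ.Tight p x b := (hcx.trichotomy hp hba (by simp [hbc])).resolve_left hcb
  have hbc' : b ≠ rev c := fun h => hu.rev_notMem (List.mem_of_getLast? hc) (by simp [← h])
  obtain ⟨q, y, b₁, b₂, b₃, b₄, b₅, b₆⟩ :=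
    exists_walk next hl {z | z ∈ (b :: u).map Γ.src} hxD
  have hyD : y ∈ D := b₂ y (List.mem_of_getLast? b₅)
  obtain ⟨n, -, hn⟩ := next y hyD
  by_cases hyu : Γ.tgt y ∈ (b :: u).map Γ.src
  · obtain ⟨m, hm, hmy⟩ := List.mem_map.1 hyu
    obtain ⟨u₁, u₂, hu₁⟩ := List.append_of_mem hm
    cases u₁ with
    | nil =>
      obtain ⟨rfl, rfl⟩ : b = m ∧ u = u₂ := by simpa using hu₁
      have hQ : Γ.IsCircleAt (Γ.src x) (x :: q) :=
        isCircleAt_of_nodup (isChain_legal b₁) b₅ (by rw [← hmy, hxb.1]) b₃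
      have hyx : rev y ≠ x := fun h => hQ.rev_notMem (List.mem_of_getLast? b₅) (by simp [h])
      refine ⟨_, _, TightLoop.of_cons b₁ b₅ ?_, .inl hQ⟩
      -- The walk has returned to the base point of the first circle. As `x` is the only negative
      -- direction there, the returning walk must close up tightly with `x`; no figure eight is
      -- needed.
      exact hxb.of_not_tight hp hcx.symm hbc' (fun h => hcb h.symm) hn
        (by rw [src_rev, ← hmy, hxb.1]) hyx
    | cons b' u₁ =>
      obtain ⟨rfl, rfl⟩ : b = b' ∧ u = u₁ ++ m :: u₂ := by simpa using hu₁
      obtain ⟨k, hk⟩ := Option.isSome_iff_exists.1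
        (List.getLast?_isSome.2 (List.cons_ne_nil b u₁))
      obtain ⟨z, β, h⟩ := exists_tight_circle_of_theta hp hu hut hk hxb
        (fun c' hc' => by
          rw [← List.cons_append, List.getLast?_append_of_ne_nil _ (by simp)] at hc
          obtain rfl : c = c' := by simpa only [Option.mem_def.1 hc, Option.mem_def,
            Option.some.injEq] using hc'
          exact hcx.symm) b₁ b₃ b₄ b₅ hmy.symm hn
      exact ⟨z, β, h.1, .inl h.2⟩
  · obtain ⟨b', hb', hb'y⟩ := List.mem_map.1 (b₆.resolve_left hyu)
    obtain ⟨W, v', hW⟩ := List.append_of_mem hb'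
    cases W with
    | nil =>
      obtain ⟨rfl, rfl⟩ : x = b' ∧ q = v' := by simpa using hW
      exact absurd (by rw [← hb'y, hxb.1]; simp) hyu
    | cons x' W =>
      obtain ⟨rfl, rfl⟩ : x = x' ∧ q = W ++ b' :: v' := by simpa using hW
      rw [← List.cons_append] at b₁ b₂ b₃ b₅
      obtain ⟨hy, hv'⟩ := isCircleAt_of_walk (isChain_legal b₁) b₅ hb'y b₃
      have hv't := (List.isChain_append.1 b₁).2.1
      obtain ⟨k, hk⟩ := Option.isSome_iff_exists.1
        (List.getLast?_isSome.2 (List.cons_ne_nil x W))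
      have hkb : Γ.Tight p (rev k) b' := (List.isChain_append.1 b₁).2.2 k hk b' (by simp)
      by_cases hyb : Γ.Tight p (rev y) b'
      · exact ⟨_, _, TightLoop.of_cons hv't hy hyb, .inl hv'⟩
      -- The second circle is not tight at its base either, so its end turns tightly back into the
      -- connecting arc, as at the first circle. This yields a barbell.
      have hky : Γ.Tight p (rev k) (rev y) :=
        (hkb.symm.trichotomy hp hn (by simp [hb'y])).resolve_left fun h => hyb h.symm
      have hWt := (List.isChain_append.1 b₁).1
      have hkinv : rev k ∈ (FreeGroup.invRev (x :: W)).head? := by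
        rw [invRev_eq, List.head?_reverse, List.getLast?_map, Option.mem_def.1 hk]; simp
      refine ⟨Γ.src b, (b :: u) ++ (x :: W) ++ (b' :: v') ++ FreeGroup.invRev (x :: W),
        ⟨by simp, ?_, ?_⟩, .inr ⟨Γ.src b', b :: u, b' :: v', x :: W, hu, hv', ?_, ?_, ?_, ?_, rfl⟩⟩
      · rw [List.append_assoc (b :: u), List.append_assoc (b :: u), List.isChain_append]
        refine ⟨hut, ?_, ?_⟩
        · rw [List.isChain_append]
          refine ⟨b₁, isChain_invRev hWt, fun y' hy' a ha => ?_⟩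
          obtain rfl : y = y' := by simpa only [Option.mem_def.1 b₅, Option.mem_def,
            Option.some.injEq] using hy'
          obtain rfl : rev k = a := by simpa only [Option.mem_def.1 hkinv, Option.mem_def,
            Option.some.injEq] using ha
          exact hky.symm
        · intro c' hc' a ha
          obtain rfl : c = c' := by simpa only [Option.mem_def.1 hc, Option.mem_def,
            Option.some.injEq] using hc'
          obtain rfl : x = a := by simpa using ha
          exact hcx
      · intro r hr a ha
        rw [List.getLast?_append_of_ne_nil _ (by simp [invRev_eq]), getLast?_invRev_cons] at hr
        obtain rfl : rev x = r := by simpa using hr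
        obtain rfl : b = a := by simpa using ha
        simpa [TightFollow] using hxb
      · intro z hz hz'
        obtain ⟨d, hd, rfl⟩ := List.mem_map.1 hz'
        exact b₄ d (List.mem_append_right _ hd) hz
      · have := isPath_of_isChain (isChain_legal hWt) k hk
        rwa [hxb.1, (by simpa using hkb.1 : Γ.tgt k = Γ.src b')] at this
      · rw [← List.map_singleton, ← List.map_append]
        refine b₃.sublist (List.Sublist.map _ ?_)
        simp
      · intro z hz
        obtain ⟨d, hd, rfl⟩ := List.mem_map.1 hz
        refine ⟨b₄ d (List.mem_append_left _ hd), fun h => ?_⟩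
        rw [List.map_append, List.nodup_append] at b₃
        exact b₃.2.2 _ (List.mem_map_of_mem (List.mem_cons_of_mem _ hd)) _ h rfl

end

/-! ### The norm -/

section
variable {Γ : TopGraph V E}

lemma pathWeight_mono_mem {w : E → ℝ} (hw : ∀ e, 0 ≤ w e) {α : List (E × Bool)} {d : E × Bool}
    (hd : d ∈ α) : w d.1 ≤ pathWeight w α := by
  obtain ⟨X, Y, rfl⟩ := List.append_of_mem hd
  have h₁ : 0 ≤ pathWeight w X := pathWeight_nonneg fun _ _ => hw _
  have h₂ : 0 ≤ pathWeight w Y := pathWeight_nonneg fun _ _ => hw _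
  simp only [pathWeight_append, pathWeight_cons]
  linarith

/-- The loop contains a circle, which is not made of zero edges alone. -/
lemma Immersed.length_pos [Finite V] [Fintype E] {l : E → ℝ} (hl : l ∈ Γ.metrics)
    {α : List (E × Bool)} (h : Γ.Immersed α) : 0 < pathWeight l α := by
  obtain ⟨v, u, hu, hα⟩ := h.exists_circle
  have h₁ : ∃ d ∈ u, l d.1 ≠ 0 := by
    by_contra! h₁
    exact hl.2.2 ⟨v, u, hu, h₁⟩
  obtain ⟨d, hd, hd0⟩ := h₁
  exact lt_of_lt_of_le (lt_of_le_of_ne (hl.1 d.1).1 hd0.symm)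
    (pathWeight_mono_mem (fun e => (hl.1 e).1) (hα d hd))

lemma pathWeight_sub_smul (c : ℝ) (l τ : E → ℝ) (α : List (E × Bool)) :
    pathWeight (c • l + (-1 : ℝ) • τ) α = c * pathWeight l α - pathWeight τ α := by
  rw [pathWeight_add, pathWeight_smul, pathWeight_smul]; ring

lemma finite_immersed_nodup [Finite E] (Γ : TopGraph V E) :
    {α | Γ.Immersed α ∧ α.Nodup}.Finite := by
  classical
  have := Fintype.ofFinite E
  have h : Finite {α : List (E × Bool) // α.Nodup} := @Finite.of_fintype _ fintypeNodupList
  exact (@Set.toFinite _ {α : List (E × Bool) | α.Nodup} h).subset fun α h => h.2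

/-- The finite set of immersed loops without repeated oriented edges. -/
noncomputable def simpleLoops [Finite E] (Γ : TopGraph V E) : Finset (List (E × Bool)) :=
  Γ.finite_immersed_nodup.toFinset

lemma mem_simpleLoops [Finite E] {α : List (E × Bool)} :
    α ∈ Γ.simpleLoops ↔ Γ.Immersed α ∧ α.Nodup := by simp [simpleLoops]

variable [Finite V] [Fintype E]

lemma simpleLoops_nonempty [Nonempty E] (Γ : TopGraph V E) : Γ.simpleLoops.Nonempty := by
  obtain ⟨α, h⟩ := Γ.exists_immersed
  exact ⟨α, mem_simpleLoops.2 h⟩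

variable {l τ : E → ℝ}

/-- If `c` is the maximum over simple loops, then `cℓ - τ` is nonnegative on them, hence on all
immersed loops by cutting. -/
lemma isGreatest_ratios [Nonempty E] (hl : l ∈ Γ.metrics) :
    IsGreatest (Γ.ratios l τ)
      (Γ.simpleLoops.sup' Γ.simpleLoops_nonempty fun α => pathWeight τ α / pathWeight l α) := by
  rw [ratios_eq]
  set c := Γ.simpleLoops.sup' Γ.simpleLoops_nonempty fun α => pathWeight τ α / pathWeight l α
    with hc
  constructor
  · obtain ⟨α, hα, h⟩ := Finset.exists_mem_eq_sup' Γ.simpleLoops_nonempty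
      fun α => pathWeight τ α / pathWeight l α
    exact ⟨α, (mem_simpleLoops.1 hα).1, h⟩
  · rintro r ⟨α, hα, rfl⟩
    rw [div_le_iff₀ (hα.length_pos hl), ← sub_nonneg, ← pathWeight_sub_smul]
    refine pathWeight_nonneg_of_nodup (fun β hβ hn => ?_) hα
    rw [pathWeight_sub_smul, sub_nonneg, ← div_le_iff₀ (hβ.length_pos hl)]
    exact Finset.le_sup' (fun α => pathWeight τ α / pathWeight l α) (mem_simpleLoops.2 ⟨hβ, hn⟩)

lemma normL_eq_sup' [Nonempty E] (hl : l ∈ Γ.metrics) :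
    Γ.normL l τ =
      Γ.simpleLoops.sup' Γ.simpleLoops_nonempty fun α => pathWeight τ α / pathWeight l α :=
  (isGreatest_ratios hl).csSup_eq

lemma exists_normL_eq [Nonempty E] (hl : l ∈ Γ.metrics) (τ : E → ℝ) :
    ∃ α, Γ.Immersed α ∧ pathWeight τ α = Γ.normL l τ * pathWeight l α := by
  have h := (isGreatest_ratios (τ := τ) hl).1
  rw [← normL_eq_sup' hl, ratios_eq] at h
  obtain ⟨α, hα, h⟩ := h
  exact ⟨α, hα, by rw [h, div_mul_cancel₀ _ (hα.length_pos hl).ne']⟩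

lemma pathWeight_le_normL [Nonempty E] (hl : l ∈ Γ.metrics) (τ : E → ℝ) {α : List (E × Bool)}
    (hα : Γ.Immersed α) : pathWeight τ α ≤ Γ.normL l τ * pathWeight l α := by
  have h := (isGreatest_ratios (τ := τ) hl).2
  rw [← normL_eq_sup' hl, ratios_eq] at h
  exact (div_le_iff₀ (hα.length_pos hl)).1 (h ⟨α, hα, rfl⟩)

lemma normL_le [Nonempty E] (hl : l ∈ Γ.metrics) {c : ℝ}
    (h : ∀ α, Γ.Immersed α → pathWeight τ α ≤ c * pathWeight l α) : Γ.normL l τ ≤ c := by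
  obtain ⟨α, hα, h'⟩ := exists_normL_eq hl τ
  exact le_of_mul_le_mul_right (h' ▸ h α hα) (hα.length_pos hl)

/-- The defect `‖τ‖ ℓ - τ` has a potential. -/
lemma exists_potential_normL [Nonempty E] (hl : l ∈ Γ.metrics) (τ : E → ℝ) :
    ∃ p, Γ.IsPotential (Γ.normL l τ • l + (-1 : ℝ) • τ) p :=
  exists_isPotential fun α hα => by
    rw [pathWeight_sub_smul, sub_nonneg]
    exact pathWeight_le_normL hl τ hα

lemma exists_candidate_normL [Nonempty E] (hl : l ∈ Γ.metrics) (τ : E → ℝ) :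
    ∃ α, Γ.IsCandidate α ∧ Γ.Immersed α ∧ pathWeight τ α = Γ.normL l τ * pathWeight l α := by
  obtain ⟨p, hp⟩ := exists_potential_normL (Γ := Γ) hl τ
  obtain ⟨α, hα, h⟩ := exists_normL_eq (Γ := Γ) hl τ
  have ht := hα.tightLoop hp (by rw [pathWeight_sub_smul, h, sub_self])
  obtain ⟨z, β, hβ, hc⟩ := ht.exists_candidate hp
  refine ⟨β, ⟨β, z, .refl _, hc.imp_right .inr⟩, hβ.immersed, ?_⟩
  have := hβ.pathWeight_eq_zero hp
  rw [pathWeight_sub_smul] at this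
  linarith

lemma continuousOn_normL [Nonempty E] (Γ : TopGraph V E) :
    ContinuousOn (fun x : (E → ℝ) × (E → ℝ) => Γ.normL x.1 x.2) (Γ.metrics ×ˢ Γ.tangent) := by
  have hc : ∀ α : List (E × Bool), Continuous fun w : E → ℝ => pathWeight w α := by
    intro α
    induction α with
    | nil => simpa using continuous_const
    | cons d α ih =>
      simp only [pathWeight_cons]
      exact (continuous_apply d.1).add ih
  refine ContinuousOn.congr (f := fun x : (E → ℝ) × (E → ℝ) =>
    Γ.simpleLoops.sup' Γ.simpleLoops_nonempty fun α => pathWeight x.2 α / pathWeight x.1 α) ?_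
    fun x hx => normL_eq_sup' hx.1
  refine ContinuousOn.finset_sup'_apply _ fun α hα => ContinuousOn.div
    ((hc α).comp continuous_snd).continuousOn ((hc α).comp continuous_fst).continuousOn
    fun x hx => ((mem_simpleLoops.1 hα).1.length_pos hx.1).ne'

/-- Under this hypothesis `-τ` is nonnegative on every loop and has total zero. -/
lemma eq_zero_of_normL_nonpos [Nonempty E] (hl : l ∈ Γ.metrics) (hτ : τ ∈ Γ.tangent)
    (h : Γ.normL l τ ≤ 0) : τ = 0 := by
  have h₁ := (sum_nonneg_of_immersed (Γ := Γ) (w := (-1 : ℝ) • τ) fun α hα => by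
    have h₁ := pathWeight_le_normL hl τ hα
    have h₂ := hα.length_pos hl
    rw [pathWeight_smul]
    nlinarith).2 (by
      have : ∑ e, τ e = 0 := hτ
      simp [this])
  simpa using h₁

lemma normL_zero [Nonempty E] (hl : l ∈ Γ.metrics) : Γ.normL l 0 = 0 := by
  obtain ⟨α, hα, h⟩ := exists_normL_eq hl (0 : E → ℝ)
  have h₀ : pathWeight (0 : E → ℝ) α = 0 := by simpa using pathWeight_smul 0 (0 : E → ℝ) α
  rw [h₀, zero_eq_mul] at h
  exact h.resolve_right (hα.length_pos hl).ne'

lemma normL_nonneg [Nonempty E] (hl : l ∈ Γ.metrics) (hτ : τ ∈ Γ.tangent) : 0 ≤ Γ.normL l τ := by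
  by_contra! h
  have := eq_zero_of_normL_nonpos hl hτ h.le
  rw [this, normL_zero hl] at h
  exact h.false

lemma normL_add_le [Nonempty E] (hl : l ∈ Γ.metrics) (τ₁ τ₂ : E → ℝ) :
    Γ.normL l (τ₁ + τ₂) ≤ Γ.normL l τ₁ + Γ.normL l τ₂ :=
  normL_le hl fun α hα => by
    rw [pathWeight_add, add_mul]
    exact add_le_add (pathWeight_le_normL hl _ hα) (pathWeight_le_normL hl _ hα)

lemma normL_smul [Nonempty E] (hl : l ∈ Γ.metrics) (τ : E → ℝ) {c : ℝ} (hc : 0 < c) :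
    Γ.normL l (c • τ) = c * Γ.normL l τ := by
  have key : ∀ (τ : E → ℝ) {c : ℝ}, 0 < c → Γ.normL l (c • τ) ≤ c * Γ.normL l τ :=
    fun τ c hc => normL_le hl fun α hα => by
      rw [pathWeight_smul, mul_assoc]
      exact mul_le_mul_of_nonneg_left (pathWeight_le_normL hl τ hα) hc.le
  refine le_antisymm (key τ hc) ?_
  have := key (c • τ) (inv_pos.2 hc)
  rwa [smul_smul, inv_mul_cancel₀ hc.ne', one_smul, le_inv_mul_iff₀ hc] at this

end

/-! ### The words of piecewise linear paths, and a lower bound for slopes -/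

section words

/-- Whether the parameter `t` lies beyond the level `c`. -/
noncomputable def level (c : ℝ) (t : unitInterval) : ℤ := if c ≤ t then 1 else 0

/-- The element of the free group that records how a path crosses the points of parameter `c` on
the edges. -/
noncomputable def crossing (c : ℝ) (p : List (EdgeSeg E)) : FreeGroup E :=
  (p.map fun x => FreeGroup.of x.edge ^ (level c x.t - level c x.s)).prod

@[simp] lemma crossing_nil (c : ℝ) : crossing c ([] : List (EdgeSeg E)) = 1 := rfl

@[simp] lemma crossing_append (c : ℝ) (p q : List (EdgeSeg E)) :
    crossing c (p ++ q) = crossing c p * crossing c q := by simp [crossing]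

@[simp] lemma crossing_cons (c : ℝ) (x : EdgeSeg E) (q : List (EdgeSeg E)) :
    crossing c (x :: q) = FreeGroup.of x.edge ^ (level c x.t - level c x.s) * crossing c q := by
  simp [crossing]

lemma reversePL_cons (x : EdgeSeg E) (p : List (EdgeSeg E)) :
    reversePL (x :: p) = reversePL p ++ [⟨x.edge, x.t, x.s⟩] := by simp [reversePL]

lemma crossing_reversePL (c : ℝ) (p : List (EdgeSeg E)) :
    crossing c (reversePL p) = (crossing c p)⁻¹ := by
  induction p with
  | nil => simp [reversePL]
  | cons x p ih => simp [reversePL_cons, ih, ← zpow_neg]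

/-- Exponents are differences of levels, so they telescope within an edge. -/
lemma ElemHomotopy.crossing_eq {p q : List (EdgeSeg E)} (h : ElemHomotopy p q) (c : ℝ) :
    crossing c p = crossing c q := by
  cases h with
  | const L R e s => simp
  | straighten L R e s t u =>
    simp only [crossing_append, crossing_cons, mul_right_inj]
    rw [← mul_assoc, ← zpow_add, sub_add_sub_cancel']

lemma Homotopic.crossing_eq {Γ : TopGraph V E} {a b : Γ.Pt} {p q : List (EdgeSeg E)}
    (h : Γ.Homotopic a b p q) (c : ℝ) : crossing c p = crossing c q := by
  obtain ⟨-, -, h⟩ := h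
  induction h with
  | rel _ _ h => exact h.2.2.crossing_eq c
  | refl => rfl
  | symm _ _ _ ih => exact ih.symm
  | trans _ _ _ _ _ ih₁ ih₂ => exact ih₁.trans ih₂

/-- Because `level` tests `c ≤ t`, the range `0 < c ≤ 1` is exactly where the ends `0` and `1` lie
on opposite sides of the level. -/
lemma crossing_dartPL {c : ℝ} (h₀ : 0 < c) (h₁ : c ≤ 1) (d : E × Bool) :
    crossing c (dartPL d) = FreeGroup.mk [d] := by
  have e₁ : level c 1 = 1 := by simp [level, h₁]
  have e₀ : level c 0 = 0 := by simp [level, h₀]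
  rcases d with ⟨e, b⟩
  cases b
  · simp [dartPL, e₁, e₀, FreeGroup.of, FreeGroup.invRev]
  · simp [dartPL, e₁, e₀, FreeGroup.of]

lemma crossing_flatMap_dartPL {c : ℝ} (h₀ : 0 < c) (h₁ : c ≤ 1) (p : List (E × Bool)) :
    crossing c (p.flatMap dartPL) = FreeGroup.mk p := by
  induction p with
  | nil => rfl
  | cons d p ih =>
    rw [List.flatMap_cons, crossing_append, ih, crossing_dartPL h₀ h₁, FreeGroup.mul_mk]
    rfl

lemma LinearMap.crossing_mapPath {Γ : TopGraph V E} {Γ' : TopGraph V' E'} (φ : Γ.LinearMap Γ')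
    (c : ℝ) (p : List (E × Bool)) :
    crossing c (φ.mapPath p) =
      FreeGroup.lift (fun e => crossing c (φ.edge e)) (FreeGroup.mk p) := by
  rw [FreeGroup.lift_mk]
  induction p with
  | nil => rfl
  | cons d p ih =>
    rcases d with ⟨e, b⟩
    rw [LinearMap.mapPath] at ih ⊢
    rw [List.flatMap_cons, crossing_append, ih, List.map_cons, List.prod_cons]
    cases b <;> simp [crossing_reversePL]

lemma exists_isPath (Γ : TopGraph V E) (u v : V) : ∃ p, Γ.IsPath u v p := by
  induction Γ.connected u v with
  | refl => exact ⟨[], rfl⟩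
  | tail _ h ih =>
    obtain ⟨p, hp⟩ := ih
    obtain ⟨e, ⟨h₁, h₂⟩ | ⟨h₁, h₂⟩⟩ := h
    · exact ⟨p ++ [(e, true)], hp.append (isPath_singleton.2 ⟨by simpa [src] using h₁, by simpa [tgt] using h₂⟩)⟩
    · exact ⟨p ++ [(e, false)], hp.append (isPath_singleton.2 ⟨by simpa [src] using h₂, by simpa [tgt] using h₁⟩)⟩

/-- A difference of a marking with itself induces an inner automorphism. -/
lemma LinearMap.IsDifference.exists_conj {Γ : TopGraph V E} {n : ℕ} {f : Γ.Marking n}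
    {φ : Γ.LinearMap Γ} (h : φ.IsDifference f f) {c : ℝ} (h₀ : 0 < c) (h₁ : c ≤ 1) {v : V}
    {α : List (E × Bool)} (hα : Γ.IsPath v v α) :
    ∃ g : FreeGroup E, crossing c (φ.mapPath α) = g * FreeGroup.mk α * g⁻¹ := by
  obtain ⟨q, -, hq⟩ := h
  set Φ := FreeGroup.lift fun e => crossing c (φ.edge e) with hΦ
  set x := crossing c q
  have hpet : ∀ i, Φ (FreeGroup.mk (f.petal i)) = x⁻¹ * FreeGroup.mk (f.petal i) * x := by
    intro i
    have := (hq i).crossing_eq c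
    rw [crossing_append, crossing_append, crossing_flatMap_dartPL h₀ h₁,
      φ.crossing_mapPath] at this
    rw [mul_assoc, this, inv_mul_cancel_left]
  -- The two homomorphisms agree on the petals. As the marking is onto the fundamental group, the
  -- map acts there as conjugation by `x⁻¹`.
  have hhom : Φ.comp (FreeGroup.lift fun i => FreeGroup.mk (f.petal i)) =
      (MulAut.conj x⁻¹).toMonoidHom.comp (FreeGroup.lift fun i => FreeGroup.mk (f.petal i)) := by
    ext i
    simp [hpet, mul_assoc]
  obtain ⟨p, hp⟩ := Γ.exists_isPath f.base v
  obtain ⟨g, hg⟩ := f.surjective _ ((hp.append hα).append hp.invRev)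
  have h₂ := DFunLike.congr_fun hhom g
  simp only [MonoidHom.comp_apply, hg] at h₂
  rw [← FreeGroup.mul_mk, ← FreeGroup.mul_mk, ← FreeGroup.inv_mk, map_mul, map_mul, map_inv] at h₂
  refine ⟨(Φ (FreeGroup.mk p))⁻¹ * x⁻¹ * FreeGroup.mk p, ?_⟩
  rw [φ.crossing_mapPath, ← hΦ]
  simp only [MulEquiv.coe_toMonoidHom, MulAut.conj_apply] at h₂
  rw [eq_comm, ← mul_right_inj (Φ (FreeGroup.mk p)), ← mul_left_inj (Φ (FreeGroup.mk p))⁻¹, h₂]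
  group

end words

/-! ### Weights of reduced words and conjugation -/

section wordWeight
open Classical

/-- The weight of the reduced word of an element of a free group. -/
noncomputable def wordWeight (w : E → ℝ) (g : FreeGroup E) : ℝ := pathWeight w g.toWord

variable {w : E → ℝ}

lemma pathWeight_le_of_sublist (hw : ∀ e, 0 ≤ w e) {p q : List (E × Bool)} (h : p.Sublist q) :
    pathWeight w p ≤ pathWeight w q := by
  refine (h.map fun d : E × Bool => w d.1).sum_le_sum fun r hr => ?_
  obtain ⟨d, -, rfl⟩ := List.mem_map.1 hr
  exact hw d.1

lemma wordWeight_mul_le (hw : ∀ e, 0 ≤ w e) (g h : FreeGroup E) :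
    wordWeight w (g * h) ≤ wordWeight w g + wordWeight w h := by
  rw [wordWeight, wordWeight, wordWeight, ← pathWeight_append]
  exact pathWeight_le_of_sublist hw (FreeGroup.toWord_mul_sublist g h)

lemma pathWeight_invRev (p : List (E × Bool)) :
    pathWeight w (FreeGroup.invRev p) = pathWeight w p := by
  simp [pathWeight, FreeGroup.invRev, Function.comp_def]

lemma wordWeight_inv (g : FreeGroup E) : wordWeight w g⁻¹ = wordWeight w g := by
  rw [wordWeight, FreeGroup.toWord_inv, pathWeight_invRev, wordWeight]

lemma wordWeight_one : wordWeight w 1 = 0 := by simp [wordWeight]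

lemma wordWeight_pow_le (hw : ∀ e, 0 ≤ w e) (g : FreeGroup E) (n : ℕ) :
    wordWeight w (g ^ n) ≤ n * wordWeight w g := by
  induction n with
  | zero => simp [wordWeight_one]
  | succ n ih =>
    rw [pow_succ]
    refine (wordWeight_mul_le hw _ _).trans ?_
    push_cast
    linarith

lemma wordWeight_of_zpow_le (hw : ∀ e, 0 ≤ w e) (e : E) (z : ℤ) :
    wordWeight w (FreeGroup.of e ^ z) ≤ w e * |(z : ℝ)| := by
  have h : ∀ n : ℕ, wordWeight w (FreeGroup.of e ^ n) ≤ w e * n := fun n => by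
    refine (wordWeight_pow_le hw _ n).trans_eq ?_
    simp [wordWeight, mul_comm]
  obtain ⟨n, rfl | rfl⟩ := z.eq_nat_or_neg
  · simpa using h n
  · simpa [wordWeight_inv] using h n

/-- Cyclically reduced words minimise the weight in their conjugacy class. -/
lemma pathWeight_le_wordWeight_conj (hw : ∀ e, 0 ≤ w e) {α : List (E × Bool)}
    (hα : FreeGroup.IsCyclicallyReduced α) (g : FreeGroup E) :
    pathWeight w α ≤ wordWeight w (g * FreeGroup.mk α * g⁻¹) := by
  set x := g * FreeGroup.mk α * g⁻¹ with hx
  -- Powers of `α` stay reduced, so their weight is exactly linear in `n`, while conjugation costs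
  -- only the constant `2 * wordWeight w g`. Comparing growth rates removes the constant.
  have hpow : ∀ n : ℕ, n * pathWeight w α ≤ n * wordWeight w x + 2 * wordWeight w g := by
    intro n
    have h₁ : wordWeight w (FreeGroup.mk α ^ n) = n * pathWeight w α := by
      rw [wordWeight, FreeGroup.pow_mk, FreeGroup.toWord_mk,
        (hα.flatten_replicate n).isReduced.reduce_eq]
      induction n with
      | zero => simp
      | succ n ih =>
        rw [List.replicate_succ, List.flatten_cons, pathWeight_append, ih]
        push_cast
        ring
    have h₂ : FreeGroup.mk α ^ n = g⁻¹ * x ^ n * g := by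
      rw [hx, conj_pow]; group
    have h₃ := wordWeight_mul_le hw (g⁻¹ * x ^ n) g
    have h₄ := wordWeight_mul_le hw g⁻¹ (x ^ n)
    have h₅ := wordWeight_pow_le hw x n
    rw [← h₂] at h₃
    rw [wordWeight_inv] at h₄
    linarith
  by_contra! hlt
  obtain ⟨n, hn⟩ := exists_nat_gt (2 * wordWeight w g / (pathWeight w α - wordWeight w x))
  rw [div_lt_iff₀ (by linarith)] at hn
  linarith [hpow n]

lemma wordWeight_crossing_le (hw : ∀ e, 0 ≤ w e) (c : ℝ) (p : List (EdgeSeg E)) :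
    wordWeight w (crossing c p) ≤
      (p.map fun x => w x.edge * |((level c x.t - level c x.s : ℤ) : ℝ)|).sum := by
  induction p with
  | nil => simp [wordWeight_one]
  | cons x p ih =>
    rw [crossing_cons, List.map_cons, List.sum_cons]
    exact (wordWeight_mul_le hw _ _).trans (add_le_add (wordWeight_of_zpow_le hw _ _) ih)

end wordWeight

/-! ### Length as an average of crossing numbers -/

section integral
open MeasureTheory

/-- For `s ≤ t` the integrand is the indicator of `(s, t]`. -/
lemma integral_level (s t : unitInterval) :
    IntegrableOn (fun c => |((level c t - level c s : ℤ) : ℝ)|) (Set.Ioc (0 : ℝ) 1) ∧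
      ∫ c in Set.Ioc (0 : ℝ) 1, |((level c t - level c s : ℤ) : ℝ)| = |(t : ℝ) - s| := by
  wlog h : s ≤ t generalizing s t
  · have := this t s (not_le.1 h).le
    simp only [level] at this ⊢
    push_cast at this ⊢
    rw [abs_sub_comm (t : ℝ)]
    simpa only [abs_sub_comm] using this
  have hf : (fun c => |((level c t - level c s : ℤ) : ℝ)|) =
      (Set.Ioc (s : ℝ) t).indicator fun _ => (1 : ℝ) := by
    funext c
    have : (s : ℝ) ≤ t := h
    by_cases h₁ : c ≤ t <;> by_cases h₂ : c ≤ s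
    · simp [level, h₁, h₂, Set.indicator]
    · simp [level, h₁, h₂, Set.indicator, not_le.1 h₂]
    · exact absurd (h₂.trans this) h₁
    · simp [level, h₁, h₂, Set.indicator]
  have hsub : Set.Ioc (s : ℝ) t ∩ Set.Ioc (0 : ℝ) 1 = Set.Ioc (s : ℝ) t := by
    refine Set.inter_eq_left.2 fun c hc => ⟨s.2.1.trans_lt hc.1, hc.2.trans t.2.2⟩
  rw [hf]
  constructor
  · exact (integrableOn_const (by simp)).indicator measurableSet_Ioc
  · rw [integral_indicator measurableSet_Ioc, Measure.restrict_restrict measurableSet_Ioc, hsub]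
    have : (0 : ℝ) ≤ t - s := sub_nonneg.2 h
    simp [abs_of_nonneg this, this]

lemma integral_crossing (w : E → ℝ) (p : List (EdgeSeg E)) :
    IntegrableOn (fun c => (p.map fun x => w x.edge * |((level c x.t - level c x.s : ℤ) : ℝ)|).sum)
        (Set.Ioc (0 : ℝ) 1) ∧
      ∫ c in Set.Ioc (0 : ℝ) 1,
        (p.map fun x => w x.edge * |((level c x.t - level c x.s : ℤ) : ℝ)|).sum = lengthPL w p := by
  induction p with
  | nil => simp [lengthPL]
  | cons x p ih =>
    simp only [List.map_cons, List.sum_cons, lengthPL]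
    have h := integral_level x.s x.t
    refine ⟨(h.1.const_mul _).add ih.1, ?_⟩
    rw [integral_add (h.1.const_mul _) ih.1, integral_const_mul, h.2, ih.2, lengthPL, mul_comm]

end integral

/-! ### Lower bound for the slope -/

section slope
variable {Γ : TopGraph V E} {n : ℕ} {f : Γ.Marking n} {φ : Γ.LinearMap Γ} {l l' : E → ℝ}

lemma lengthPL_append (l : E → ℝ) (p q : List (EdgeSeg E)) :
    lengthPL l (p ++ q) = lengthPL l p + lengthPL l q := by simp [lengthPL]

lemma lengthPL_reversePL (l : E → ℝ) (p : List (EdgeSeg E)) :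
    lengthPL l (reversePL p) = lengthPL l p := by
  simp [lengthPL, reversePL, Function.comp_def, abs_sub_comm]

lemma LinearMap.lengthPL_mapPath (φ : Γ.LinearMap Γ) (l : E → ℝ) (α : List (E × Bool)) :
    lengthPL l (φ.mapPath α) = pathWeight (fun e => lengthPL l (φ.edge e)) α := by
  induction α with
  | nil => rfl
  | cons d α ih =>
    rw [LinearMap.mapPath] at ih ⊢
    rw [List.flatMap_cons, lengthPL_append, ih, pathWeight_cons]
    split <;> simp [lengthPL_reversePL]

/-- At every level `c` the crossing word of the image is conjugate to `α`, so its weight is at least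
that of `α`. Averaging over `c` turns the weighted crossing numbers into length. -/
lemma LinearMap.IsDifference.le_lengthPL (h : φ.IsDifference f f) (hl : ∀ e, 0 ≤ l e)
    {α : List (E × Bool)} (hα : Γ.Immersed α) : pathWeight l α ≤ lengthPL l (φ.mapPath α) := by
  obtain ⟨-, ⟨v, hv⟩, hc⟩ := immersed_iff.1 hα
  obtain ⟨h₁, h₂⟩ := integral_crossing l (φ.mapPath α)
  have h₃ : ∫ _ in Set.Ioc (0 : ℝ) 1, pathWeight l α = pathWeight l α := by simp
  rw [← h₂, ← h₃]
  refine MeasureTheory.setIntegral_mono_on (MeasureTheory.integrableOn_const (by simp)) h₁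
    measurableSet_Ioc fun c hc' => ?_
  obtain ⟨g, hg⟩ := h.exists_conj hc'.1 hc'.2 hv
  refine (pathWeight_le_wordWeight_conj hl hc g).trans ?_
  rw [← hg]
  exact wordWeight_crossing_le hl c _

/-- A map stretches no loop by more than its slope. -/
lemma LinearMap.IsDifference.le_slope_mul [Finite E] (h : φ.IsDifference f f)
    (hd : φ.Descends l l') (hl : ∀ e, 0 ≤ l e) (hl' : ∀ e, 0 ≤ l' e)
    {α : List (E × Bool)} (hα : Γ.Immersed α) :
    pathWeight l' α ≤ φ.slope l l' * pathWeight l α := by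
  refine (h.le_lengthPL hl' hα).trans ?_
  rw [φ.lengthPL_mapPath]
  have key : ∀ e, lengthPL l' (φ.edge e) ≤ φ.slope l l' * l e := fun e => by
    rcases (hl e).eq_or_lt with h0 | h0
    · rw [hd e h0.symm, ← h0, mul_zero]
    · rw [← div_le_iff₀ h0]
      exact le_ciSup (f := fun e => lengthPL l' (φ.edge e) / l e) (Set.finite_range _).bddAbove e
  clear hα
  induction α with
  | nil => simp
  | cons d α ih =>
    rw [pathWeight_cons, pathWeight_cons, mul_add]
    exact add_le_add (key _) ih

end slope

/-! ### Homotopies of piecewise linear paths -/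

section
variable {Γ : TopGraph V E} {a b c x y : Γ.Pt} {p q r L R : List (EdgeSeg E)}

lemma isPLPath_append : Γ.IsPLPath a b (p ++ q) ↔ ∃ m, Γ.IsPLPath a m p ∧ Γ.IsPLPath m b q := by
  induction p generalizing a with
  | nil => simp [IsPLPath]
  | cons x p ih => simp [IsPLPath, ih, and_assoc]

lemma IsPLPath.append (h : Γ.IsPLPath a b p) (h' : Γ.IsPLPath b c q) :
    Γ.IsPLPath a c (p ++ q) := isPLPath_append.2 ⟨_, h, h'⟩

lemma isPLPath_seg (e : E) (s t : unitInterval) :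
    Γ.IsPLPath (Γ.pos e s) (Γ.pos e t) [⟨e, s, t⟩] := ⟨rfl, rfl⟩

lemma IsPLPath.reverse (h : Γ.IsPLPath a b p) : Γ.IsPLPath b a (reversePL p) := by
  induction p generalizing a with
  | nil => exact h.symm
  | cons x p ih =>
    rw [reversePL_cons]
    exact (ih h.2).append ⟨rfl, h.1⟩

lemma Homotopic.refl (h : Γ.IsPLPath a b p) : Γ.Homotopic a b p p := ⟨h, h, .refl _⟩

lemma Homotopic.symm (h : Γ.Homotopic a b p q) : Γ.Homotopic a b q p :=
  ⟨h.2.1, h.1, .symm _ _ h.2.2⟩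

lemma Homotopic.trans (h : Γ.Homotopic a b p q) (h' : Γ.Homotopic a b q r) :
    Γ.Homotopic a b p r := ⟨h.1, h'.2.1, .trans _ _ _ h.2.2 h'.2.2⟩

lemma ElemHomotopy.homotopic (h : ElemHomotopy p q) (hp : Γ.IsPLPath a b p)
    (hq : Γ.IsPLPath a b q) : Γ.Homotopic a b p q := ⟨hp, hq, .rel _ _ ⟨hp, hq, h⟩⟩

lemma ElemHomotopy.append (h : ElemHomotopy p q) (L R : List (EdgeSeg E)) :
    ElemHomotopy (L ++ p ++ R) (L ++ q ++ R) := by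
  cases h with
  | const L' R' e s => simpa using ElemHomotopy.const (L ++ L') (R' ++ R) e s
  | straighten L' R' e s t u => simpa using ElemHomotopy.straighten (L ++ L') (R' ++ R) e s t u

lemma Homotopic.append (h : Γ.Homotopic a b p q) (hL : Γ.IsPLPath x a L)
    (hR : Γ.IsPLPath b y R) : Γ.Homotopic x y (L ++ p ++ R) (L ++ q ++ R) := by
  refine ⟨(hL.append h.1).append hR, (hL.append h.2.1).append hR, ?_⟩
  obtain ⟨-, -, h⟩ := h
  induction h with
  | rel _ _ h =>
    exact .rel _ _ ⟨(hL.append h.1).append hR, (hL.append h.2.1).append hR, h.2.2.append L R⟩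
  | refl => exact .refl _
  | symm _ _ _ ih => exact .symm _ _ ih
  | trans _ _ _ _ _ ih₁ ih₂ => exact .trans _ _ _ ih₁ ih₂

lemma Homotopic.append_left (h : Γ.Homotopic a b p q) (hL : Γ.IsPLPath x a L) :
    Γ.Homotopic x b (L ++ p) (L ++ q) := by
  simpa using h.append hL (R := []) rfl

lemma Homotopic.append_right (h : Γ.Homotopic a b p q) (hR : Γ.IsPLPath b y R) :
    Γ.Homotopic a y (p ++ R) (q ++ R) := by
  simpa using h.append (L := []) rfl hR

lemma homotopic_const (e : E) (s : unitInterval) :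
    Γ.Homotopic (Γ.pos e s) (Γ.pos e s) [⟨e, s, s⟩] [] :=
  (ElemHomotopy.const [] [] e s).homotopic (isPLPath_seg e s s) rfl

lemma homotopic_straighten (e : E) (s t u : unitInterval) :
    Γ.Homotopic (Γ.pos e s) (Γ.pos e u) [⟨e, s, t⟩, ⟨e, t, u⟩] [⟨e, s, u⟩] :=
  (ElemHomotopy.straighten [] [] e s t u).homotopic
    ((isPLPath_seg e s t).append (isPLPath_seg e t u)) (isPLPath_seg e s u)

lemma IsPLPath.homotopic_cancel (h : Γ.IsPLPath a b p) :
    Γ.Homotopic a a (p ++ reversePL p) [] := by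
  induction p generalizing a with
  | nil => exact Homotopic.refl rfl
  | cons x p ih =>
    obtain ⟨rfl, h⟩ := h
    have h₁ := (ih h).append (isPLPath_seg x.edge x.s x.t) (isPLPath_seg x.edge x.t x.s)
    have h₂ := (h₁.trans (homotopic_straighten x.edge x.s x.t x.s)).trans
      (homotopic_const x.edge x.s)
    simpa [reversePL_cons] using h₂

/-- The parameter on the edge `d.1` of the point at fraction `s` of the oriented edge `d`. -/
def dartParam (d : E × Bool) (s : unitInterval) : unitInterval :=
  if d.2 then s else unitInterval.symm s

/-- A piece of the oriented edge `d`. -/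
def dartSeg (d : E × Bool) (s t : unitInterval) : EdgeSeg E :=
  ⟨d.1, dartParam d s, dartParam d t⟩

/-- The point at fraction `s` of the oriented edge `d`. -/
noncomputable def dartPos (Γ : TopGraph V E) (d : E × Bool) (s : unitInterval) : Γ.Pt :=
  Γ.pos d.1 (dartParam d s)

lemma pos_zero (e : E) : Γ.pos e 0 = Sum.inl (Γ.init e) := by simp [pos]
lemma pos_one (e : E) : Γ.pos e 1 = Sum.inl (Γ.term e) := by simp [pos]

lemma dartPos_zero (d : E × Bool) : Γ.dartPos d 0 = Sum.inl (Γ.src d) := by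
  rcases d with ⟨e, b⟩
  cases b <;> simp [dartPos, dartParam, src, pos_zero, pos_one]

lemma dartPos_one (d : E × Bool) : Γ.dartPos d 1 = Sum.inl (Γ.tgt d) := by
  rcases d with ⟨e, b⟩
  cases b <;> simp [dartPos, dartParam, tgt, pos_zero, pos_one]

lemma dartParam_rev (d : E × Bool) (s : unitInterval) :
    dartParam (rev d) s = dartParam d (unitInterval.symm s) := by
  rcases d with ⟨e, b⟩
  cases b <;> simp [rev, dartParam]

lemma dartSeg_rev (d : E × Bool) (s t : unitInterval) :
    dartSeg (rev d) s t = dartSeg d (unitInterval.symm s) (unitInterval.symm t) := by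
  simp [dartSeg, dartParam_rev]

lemma dartPL_eq (d : E × Bool) : dartPL d = [dartSeg d 0 1] := by
  rcases d with ⟨e, b⟩
  cases b <;> simp [dartPL, dartSeg, dartParam]

lemma isPLPath_dartSeg (d : E × Bool) (s t : unitInterval) :
    Γ.IsPLPath (Γ.dartPos d s) (Γ.dartPos d t) [dartSeg d s t] := ⟨rfl, rfl⟩

lemma homotopic_dartSeg_const (d : E × Bool) (s : unitInterval) :
    Γ.Homotopic (Γ.dartPos d s) (Γ.dartPos d s) [dartSeg d s s] [] := homotopic_const _ _

lemma homotopic_dartSeg (d : E × Bool) (s t u : unitInterval) :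
    Γ.Homotopic (Γ.dartPos d s) (Γ.dartPos d u) [dartSeg d s t, dartSeg d t u] [dartSeg d s u] :=
  homotopic_straighten _ _ _ _

lemma lengthPL_dartSeg (l : E → ℝ) (d : E × Bool) (s t : unitInterval) :
    lengthPL l [dartSeg d s t] = |(t : ℝ) - s| * l d.1 := by
  rcases d with ⟨e, b⟩
  cases b <;> simp [lengthPL, dartSeg, dartParam, abs_sub_comm]

lemma isPLPath_dartPL (d : E × Bool) :
    Γ.IsPLPath (Sum.inl (Γ.src d)) (Sum.inl (Γ.tgt d)) (dartPL d) := by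
  rw [dartPL_eq, ← dartPos_zero, ← dartPos_one]
  exact isPLPath_dartSeg d 0 1

lemma IsPath.isPLPath {u v : V} {k : List (E × Bool)} (h : Γ.IsPath u v k) :
    Γ.IsPLPath (Sum.inl u) (Sum.inl v) (k.flatMap dartPL) := by
  induction k generalizing u with
  | nil => exact congrArg _ h
  | cons d k ih =>
    obtain ⟨rfl, h⟩ := h
    rw [List.flatMap_cons]
    exact (isPLPath_dartPL d).append (ih h)

lemma lengthPL_flatMap_dartPL (l : E → ℝ) (k : List (E × Bool)) :
    lengthPL l (k.flatMap dartPL) = pathWeight l k := by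
  induction k with
  | nil => rfl
  | cons d k ih =>
    rw [List.flatMap_cons, lengthPL_append, ih, dartPL_eq, lengthPL_dartSeg]
    simp

lemma IsPath.homotopic_of_step {u v : V} {k k' : List (E × Bool)} (h : Γ.IsPath u v k)
    (s : FreeGroup.Red.Step k k') :
    Γ.Homotopic (Sum.inl u) (Sum.inl v) (k.flatMap dartPL) (k'.flatMap dartPL) := by
  cases s with
  | @not L₁ L₂ e b =>
    obtain ⟨m, h₁, h₂, h₃, h₄⟩ := isPath_append.1 h
    have h₅ : Γ.tgt (rev (e, b)) = m := by rw [tgt_rev, h₂]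
    have h₄ : Γ.IsPath m v L₂ := by rwa [← h₅]
    have key := (homotopic_dartSeg (Γ := Γ) (e, b) 0 1 0).trans (homotopic_dartSeg_const (e, b) 0)
    rw [dartPos_zero, h₂] at key
    have := key.append h₁.isPLPath h₄.isPLPath
    have hr : dartPL (e, !b) = [dartSeg (e, b) 1 0] := by
      rw [dartPL_eq, show (e, !b) = rev (e, b) from rfl, dartSeg_rev]; simp
    simpa [hr, dartPL_eq] using this

lemma IsPath.homotopic_of_red {u v : V} {k k' : List (E × Bool)} (h : Γ.IsPath u v k)
    (s : FreeGroup.Red k k') :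
    Γ.Homotopic (Sum.inl u) (Sum.inl v) (k.flatMap dartPL) (k'.flatMap dartPL) := by
  induction s with
  | refl => exact Homotopic.refl h.isPLPath
  | tail h' s ih => exact ih.trans ((isPath_of_red h' h).homotopic_of_step s)

/-- By confluence both words reduce to a common one, and each cancellation is a homotopy. -/
lemma IsPath.homotopic_of_mk_eq {u v : V} {k k' : List (E × Bool)} (h : Γ.IsPath u v k)
    (h' : Γ.IsPath u v k') (hk : FreeGroup.mk k = FreeGroup.mk k') :
    Γ.Homotopic (Sum.inl u) (Sum.inl v) (k.flatMap dartPL) (k'.flatMap dartPL) := by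
  obtain ⟨m, h₁, h₂⟩ := FreeGroup.Red.exact.1 hk
  exact (h.homotopic_of_red h₁).trans (h'.homotopic_of_red h₂).symm

end

/-! ### Moving the vertices along a potential -/

section
variable {Γ : TopGraph V E} {l τ : E → ℝ} {p : E × Bool → ℝ} {N : ℝ}

lemma tighten_sublist (α : List (E × Bool)) : (tighten α).Sublist α := by
  classical
  have hc := FreeGroup.reduceCyclically.conj_conjugator_reduceCyclically (FreeGroup.reduce α)
  have ht : tighten α = FreeGroup.reduceCyclically (FreeGroup.reduce α) := by
    unfold tighten; congr!
  rw [ht]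
  refine List.Sublist.trans ?_ (FreeGroup.reduce.red (L := α)).sublist
  conv_rhs => rw [← hc]
  exact (List.sublist_append_right _ _).trans (List.sublist_append_left _ _)

variable (Γ l) in
/-- `k` is an edge path through edges of length zero. -/
def ZeroPath (u v : V) (k : List (E × Bool)) : Prop := Γ.IsPath u v k ∧ ∀ d ∈ k, l d.1 = 0

lemma ZeroPath.append {u v x : V} {k k' : List (E × Bool)} (h : Γ.ZeroPath l u v k)
    (h' : Γ.ZeroPath l v x k') : Γ.ZeroPath l u x (k ++ k') :=
  ⟨h.1.append h'.1, fun d hd => (List.mem_append.1 hd).elim (h.2 d) (h'.2 d)⟩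

lemma ZeroPath.invRev {u v : V} {k : List (E × Bool)} (h : Γ.ZeroPath l u v k) :
    Γ.ZeroPath l v u (FreeGroup.invRev k) := by
  refine ⟨h.1.invRev, fun d hd => ?_⟩
  rw [invRev_eq, List.mem_reverse] at hd
  obtain ⟨d', hd', rfl⟩ := List.mem_map.1 hd
  exact h.2 d' hd'

/-- The edges of length zero form a forest. -/
lemma ZeroPath.mk_eq [Finite V] [Fintype E] (hl : l ∈ Γ.metrics) {u v : V}
    {k k' : List (E × Bool)} (h : Γ.ZeroPath l u v k) (h' : Γ.ZeroPath l u v k') :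
    FreeGroup.mk k = FreeGroup.mk k' := by
  by_contra hne
  have h₁ := h.append h'.invRev
  have h₂ : Γ.IsLoop (k ++ FreeGroup.invRev k') := ⟨⟨u, h₁.1⟩, fun h0 => hne <| by
    rwa [← FreeGroup.mul_mk, ← FreeGroup.inv_mk, mul_inv_eq_one] at h0⟩
  have h₃ := h₂.immersed_tighten.length_pos hl
  have h₄ : pathWeight l (tighten (k ++ FreeGroup.invRev k')) = 0 := by
    refine List.sum_eq_zero fun r hr => ?_
    obtain ⟨d, hd, rfl⟩ := List.mem_map.1 hr
    exact h₁.2 d ((tighten_sublist _).subset hd)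
  linarith

lemma ZeroPath.exists_reduced {u v : V} {k : List (E × Bool)} (h : Γ.ZeroPath l u v k) :
    ∃ k, Γ.ZeroPath l u v k ∧ k.IsChain Γ.Legal := by
  classical
  have hr := FreeGroup.reduce.red (L := k)
  have hp := isPath_of_red hr h.1
  exact ⟨FreeGroup.reduce k, ⟨hp, fun d hd => h.2 d (hr.sublist.subset hd)⟩,
    isChain_legal_iff.2 ⟨FreeGroup.isReduced_iff_reduce_eq.2 FreeGroup.reduce.idem,
      .inr ⟨_, _, hp⟩⟩⟩

variable (Γ l τ p) in
/-- The point at distance `s` along the oriented edge `d` is the target of a zero component. -/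
structure IsRoot (d : E × Bool) (s : ℝ) : Prop where
  nonneg : 0 ≤ s
  neg_le : -s ≤ p d
  le_abs : s ≤ |p d|
  le_of_ne : ∀ d', Γ.src d' = Γ.src d → d' ≠ d → s ≤ p d'
  le_of_zero : l d.1 = 0 → s ≤ τ d.1

/-- A vertex without negative directions is a root with `s = 0`. Otherwise take `s = -p d` for a
negative direction `d`; this fails only if `d` is a zero edge too short to contain the move, and
then the search passes to the far end of `d`. It cannot go on forever, since the zero edges form a
forest. -/
lemma exists_isRoot [Finite V] [Fintype E] (hl : l ∈ Γ.metrics) (hτ : Integrable l τ)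
    (hp : Γ.IsPotential (N • l + (-1 : ℝ) • τ) p) (v : V) :
    ∃ d s k, Γ.IsRoot l τ p d s ∧ Γ.ZeroPath l v (Γ.src d) k := by
  by_contra! hcon
  have step : ∀ r k, Γ.ZeroPath l v r k → ∃ d, Γ.src d = r ∧ p d < 0 ∧ 0 < p (rev d) ∧
      l d.1 = 0 := by
    intro r k hk
    have h₁ : ∃ d, Γ.src d = r ∧ p d < 0 := by
      by_contra! h₁
      obtain ⟨d, rfl⟩ := Γ.exists_src_eq r
      refine hcon d 0 k ⟨le_rfl, by simpa using h₁ d rfl, abs_nonneg _,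
        fun d' hd' _ => h₁ d' hd', fun h0 => ?_⟩ hk
      by_contra! h
      exact (hτ _ h).ne' h0
    obtain ⟨d, rfl, hd⟩ := h₁
    have h₂ : ¬ (l d.1 = 0 → -p d ≤ τ d.1) := fun h₂ =>
      hcon d (-p d) k ⟨by linarith, by linarith, neg_le_abs _, fun d' hd' hne => by
        have := hp.turn d' d hd' hne
        linarith, h₂⟩ hk
    push Not at h₂
    have h₃ := hp.edge d
    simp [h₂.1] at h₃
    exact ⟨d, rfl, hd, by linarith [h₂.2], h₂.1⟩
  let D : Set (E × Bool) := {d | (∃ k, Γ.ZeroPath l v (Γ.src d) k) ∧ p d < 0 ∧ 0 < p (rev d) ∧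
    l d.1 = 0}
  obtain ⟨d₀, h₀, h₀'⟩ := step v [] ⟨rfl, by simp⟩
  have hd₀ : d₀ ∈ D := ⟨⟨[], h₀.symm, by simp⟩, h₀'⟩
  have next : ∀ d ∈ D, ∃ d' ∈ D, Γ.Legal d d' := by
    rintro d ⟨⟨k, hk⟩, h₁, h₂, h₃⟩
    have hk' : Γ.ZeroPath l v (Γ.tgt d) (k ++ [d]) := hk.append ⟨⟨rfl, rfl⟩, by simpa using h₃⟩
    obtain ⟨d', h', h''⟩ := step _ _ hk'
    -- The next negative direction cannot lead back: `p (rev d) > 0`.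
    refine ⟨d', ⟨⟨_, h' ▸ hk'⟩, h''⟩, h'.symm, ?_⟩
    rintro rfl
    linarith [h''.1]
  obtain ⟨q, x, a₁, a₂, a₃, -, a₅, a₆⟩ := exists_walk next (fun _ _ h => h.1) ∅ hd₀
  obtain ⟨b, hb, hbx⟩ := List.mem_map.1 (a₆.resolve_left (by simp))
  obtain ⟨P, u, hP⟩ := List.append_of_mem hb
  rw [hP] at a₁ a₂ a₃ a₅
  exact hl.2.2 ⟨_, _, (isCircleAt_of_walk a₁ a₅ hbx a₃).2,
    fun d hd => (a₂ d (List.mem_append_right _ hd)).2.2.2⟩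

/-- A choice of roots that is constant on the components of the zero forest. -/
lemma exists_roots [Finite V] [Fintype E] (hl : l ∈ Γ.metrics) (hτ : Integrable l τ)
    (hp : Γ.IsPotential (N • l + (-1 : ℝ) • τ) p) :
    ∃ (δ : V → E × Bool) (s : V → ℝ) (K : V → List (E × Bool)),
      (∀ v, Γ.IsRoot l τ p (δ v) (s v)) ∧
      (∀ v, Γ.ZeroPath l v (Γ.src (δ v)) (K v) ∧ (K v).IsChain Γ.Legal) ∧
      ∀ e, l e = 0 → δ (Γ.init e) = δ (Γ.term e) ∧ s (Γ.init e) = s (Γ.term e) := by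
  let S : Setoid V := ⟨fun u v => ∃ k, Γ.ZeroPath l u v k, fun v => ⟨[], rfl, by simp⟩,
    fun ⟨_, h⟩ => ⟨_, h.invRev⟩, fun ⟨_, h⟩ ⟨_, h'⟩ => ⟨_, h.append h'⟩⟩
  choose δ s k hr hk using exists_isRoot hl hτ hp
  -- Choosing the root through a representative makes it the same throughout each zero component.
  let ρ : V → V := fun v => (Quotient.mk S v).out
  have hρ : ∀ v, ∃ k, Γ.ZeroPath l v (Γ.src (δ (ρ v))) k ∧ k.IsChain Γ.Legal := fun v => by
    obtain ⟨k', hk'⟩ : ∃ k, Γ.ZeroPath l v (ρ v) k := S.symm (Quotient.mk_out (s := S) v)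
    exact (hk'.append (hk (ρ v))).exists_reduced
  choose K hK using hρ
  refine ⟨fun v => δ (ρ v), fun v => s (ρ v), K, fun v => hr _, hK, fun e he => ?_⟩
  have : ρ (Γ.init e) = ρ (Γ.term e) := by
    have h : S (Γ.init e) (Γ.term e) :=
      ⟨[(e, true)], ⟨by simp [src], by simp [IsPath, tgt]⟩, by simpa using he⟩
    simp only [ρ]
    rw [Quotient.sound h]
  simp only [this, and_self]

/-- Following a path of zero edges adds up the potential. -/
lemma pathWeight_add_le_potential (hp : Γ.IsPotential (N • l + (-1 : ℝ) • τ) p)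
    {c e : E × Bool} {k : List (E × Bool)} (hk : (c :: k).IsChain Γ.Legal)
    (h0 : ∀ d ∈ c :: k, l d.1 = 0) (he : Γ.src e = Γ.src c) (hec : e ≠ c) :
    ∀ x ∈ (c :: k).getLast?, pathWeight τ (c :: k) + p (rev x) ≤ p e := by
  induction k generalizing c e with
  | nil =>
    have h₁ := hp.turn e c he hec
    have h₂ := hp.edge c
    simp [h0 c (by simp)] at h₂ ⊢
    linarith
  | cons c' k ih =>
    intro x hx
    rw [List.isChain_cons_cons] at hk
    have h₁ := hp.turn e c he hec
    have h₂ := hp.edge c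
    have h₃ := ih (e := rev c) hk.2 (fun d hd => h0 d (List.mem_cons_of_mem _ hd))
      (by simpa using hk.1.1) hk.1.2.symm x (by simpa using hx)
    simp [h0 c (by simp)] at h₂
    rw [pathWeight_cons]
    linarith

/-- The track of a vertex, starting with a given edge of positive length. -/
lemma exists_track (hp : Γ.IsPotential (N • l + (-1 : ℝ) • τ) p) {t s : ℝ} (ht : 0 ≤ t)
    {d e : E × Bool} (hr : Γ.IsRoot l τ p d s) {k : List (E × Bool)}
    (hk : Γ.ZeroPath l (Γ.src e) (Γ.src d) k) (hk' : k.IsChain Γ.Legal)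
    (he : l e.1 ≠ 0) {θ : unitInterval} (hθ : (θ : ℝ) * (l + t • τ) d.1 = t * s)
    (hθ' : l d.1 ≠ 0 → (θ : ℝ) ≤ 1 / 2) :
    ∃ (η : unitInterval) (Q : List (EdgeSeg E)), (η : ℝ) ≤ 1 / 2 ∧
      Γ.Homotopic (Sum.inl (Γ.src e)) (Γ.dartPos d θ)
        (k.flatMap dartPL ++ [dartSeg d 0 θ]) (dartSeg e 0 η :: Q) ∧
      lengthPL (l + t • τ) Q - η * (l + t • τ) e.1 ≤ t * p e := by
  have hq : Γ.IsPLPath (Sum.inl (Γ.src e)) (Γ.dartPos d θ)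
      (k.flatMap dartPL ++ [dartSeg d 0 θ]) :=
    hk.1.isPLPath.append (by rw [← dartPos_zero]; exact isPLPath_dartSeg d 0 θ)
  have hlen : lengthPL (l + t • τ) [dartSeg d 0 θ] = t * s := by
    rw [lengthPL_dartSeg, ← hθ]; simp [abs_of_nonneg θ.2.1]
  have hkl : ∀ k : List (E × Bool), (∀ d ∈ k, l d.1 = 0) →
      pathWeight (l + t • τ) k = t * pathWeight τ k := fun k hk => by
    have : pathWeight l k = 0 := by
      refine List.sum_eq_zero fun r hr => ?_
      obtain ⟨d, hd, rfl⟩ := List.mem_map.1 hr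
      exact hk d hd
    rw [pathWeight_add, pathWeight_smul, this, zero_add]
  have generic : ∀ Q, Γ.Homotopic (Sum.inl (Γ.src e)) (Γ.dartPos d θ)
        (k.flatMap dartPL ++ [dartSeg d 0 θ]) Q → lengthPL (l + t • τ) Q ≤ t * p e →
      ∃ (η : unitInterval) (Q : List (EdgeSeg E)), (η : ℝ) ≤ 1 / 2 ∧
      Γ.Homotopic (Sum.inl (Γ.src e)) (Γ.dartPos d θ)
        (k.flatMap dartPL ++ [dartSeg d 0 θ]) (dartSeg e 0 η :: Q) ∧
      lengthPL (l + t • τ) Q - η * (l + t • τ) e.1 ≤ t * p e := by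
    intro Q hQ hlen
    refine ⟨0, Q, by simp, ?_, by simpa using hlen⟩
    have h := homotopic_dartSeg_const (Γ := Γ) e 0
    rw [dartPos_zero] at h
    exact hQ.trans (h.append_right hQ.2.1).symm
  cases k with
  | nil =>
    have hs : Γ.src e = Γ.src d := hk.1
    by_cases hed : e = d
    · subst hed
      -- The vertex moves into `e` itself, which saves the length `t * s`, and `-s ≤ p e`.
      refine ⟨θ, [], hθ' he, by simpa using Homotopic.refl hq, ?_⟩
      rw [hθ]
      have := mul_le_mul_of_nonneg_left hr.neg_le ht
      simp [lengthPL]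
      linarith
    · exact generic _ (Homotopic.refl hq) (by
        simp only [List.flatMap_nil, List.nil_append, hlen]
        exact mul_le_mul_of_nonneg_left (hr.le_of_ne e hs hed) ht)
  | cons c k =>
    have hsc : Γ.src e = Γ.src c := hk.1.1.symm
    have hec : e ≠ c := fun h => he (h ▸ hk.2 c (by simp))
    obtain ⟨x, hx⟩ := Option.isSome_iff_exists.1 (List.getLast?_isSome.2 (List.cons_ne_nil c k))
    have htel := pathWeight_add_le_potential hp hk' hk.2 hsc hec x hx
    have hxd : Γ.tgt x = Γ.src d := hk.1.tgt_getLast x hx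
    -- If the root edge runs back over the last zero edge `x`, straightening saves `t * s`, and `-s
    -- ≤ p (rev x)` is used. Otherwise the extra length `t * s` is bounded by `t * p (rev x)`.
    by_cases hdx : d = rev x
    · obtain ⟨k₀, hk₀⟩ := List.getLast?_eq_some_iff.1 hx
      rw [hk₀] at hk hq htel generic ⊢
      obtain ⟨m, hm, hmx⟩ := isPath_append.1 hk.1
      obtain rfl : Γ.src x = m := hmx.1
      have h₁ := homotopic_dartSeg (Γ := Γ) x 0 1 (unitInterval.symm θ)
      rw [dartPos_zero] at h₁
      have h₂ := h₁.append_left hm.isPLPath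
      have h₃ : dartSeg d 0 θ = dartSeg x 1 (unitInterval.symm θ) := by
        rw [hdx, dartSeg_rev]; simp
      have h₄ : Γ.dartPos d θ = Γ.dartPos x (unitInterval.symm θ) := by
        rw [dartPos, hdx, dartParam_rev]; rfl
      refine generic (k₀.flatMap dartPL ++ [dartSeg x 0 (unitInterval.symm θ)]) ?_ ?_
      · rw [h₃, h₄]
        simpa [dartPL_eq] using h₂
      · rw [lengthPL_append, lengthPL_flatMap_dartPL, lengthPL_dartSeg]
        have h₅ := hkl _ hk.2
        simp only [pathWeight_append, pathWeight_cons, pathWeight_nil, add_zero] at h₅ htel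
        have h₆ : |((unitInterval.symm θ : unitInterval) : ℝ) - ((0 : unitInterval) : ℝ)| =
            1 - θ := by
          simp [abs_of_nonneg (sub_nonneg.2 θ.2.2)]
        rw [h₆]
        have h₇ : d.1 = x.1 := by rw [hdx]; rfl
        rw [h₇] at hθ
        have h₈ := hr.neg_le
        rw [hdx] at h₈
        have h₉ := mul_le_mul_of_nonneg_left htel ht
        have h₁₀ := mul_le_mul_of_nonneg_left h₈ ht
        linarith
    · refine generic _ (Homotopic.refl hq) ?_
      rw [lengthPL_append, hlen, lengthPL_flatMap_dartPL, hkl _ hk.2]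
      have h₁ := hr.le_of_ne (rev x) (by simpa using hxd) (Ne.symm hdx)
      have h₂ := mul_le_mul_of_nonneg_left htel ht
      have h₃ := mul_le_mul_of_nonneg_left h₁ ht
      linarith

end

/-! ### An optimal map, and the derivative of the Lipschitz distance -/

section
variable {Γ : TopGraph V E} {l τ : E → ℝ} {p : E × Bool → ℝ} {N t : ℝ}

variable (l τ t) in
/-- The fraction of the oriented edge `d` corresponding to the distance `t * s`. -/
noncomputable def rootParam (d : E × Bool) (s : ℝ) : unitInterval :=
  Set.projIcc 0 1 zero_le_one (t * s / (l + t • τ) d.1)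

/-- The projection onto `[0, 1]` never truncates here. The bound `1 / 2` leaves room for both ends
of an edge to move into it. -/
lemma rootParam_spec {d : E × Bool} {s : ℝ} (hr : Γ.IsRoot l τ p d s) (ht : 0 ≤ t)
    (h : l d.1 ≠ 0 → 0 < (l + t • τ) d.1 ∧ 2 * (t * |p d|) ≤ (l + t • τ) d.1) :
    (rootParam l τ t d s : ℝ) * (l + t • τ) d.1 = t * s ∧
      (l d.1 ≠ 0 → (rootParam l τ t d s : ℝ) ≤ 1 / 2) := by
  set L := (l + t • τ) d.1 with hL
  have hts : 0 ≤ t * s := mul_nonneg ht hr.nonneg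
  by_cases h0 : l d.1 = 0
  · refine ⟨?_, fun h => absurd h0 h⟩
    have h₁ : L = t * τ d.1 := by simp [hL, h0]
    have h₂ : t * s ≤ L := h₁ ▸ mul_le_mul_of_nonneg_left (hr.le_of_zero h0) ht
    -- An edge that stays at length zero forces `t * s = 0`, so any parameter would do.
    rcases (hts.trans h₂).eq_or_lt with h₃ | h₃
    · rw [← h₃, mul_zero]
      exact le_antisymm hts (h₃ ▸ h₂)
    · rw [rootParam, Set.projIcc_of_mem _ ⟨div_nonneg hts h₃.le, (div_le_one h₃).2 h₂⟩,
        div_mul_cancel₀ _ h₃.ne']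
  · obtain ⟨h₁, h₂⟩ := h h0
    have h₃ : t * s / L ≤ 1 / 2 := by
      rw [div_le_iff₀ h₁]
      have := mul_le_mul_of_nonneg_left hr.le_abs ht
      linarith
    have h₄ : t * s / L ∈ Set.Icc (0 : ℝ) 1 := ⟨div_nonneg hts h₁.le, h₃.trans (by norm_num)⟩
    rw [rootParam, Set.projIcc_of_mem _ h₄]
    exact ⟨div_mul_cancel₀ _ h₁.ne', fun _ => h₃⟩

/-- For small `t` there is a map homotopic to the identity that stretches no edge by more than
`1 + t * N`. -/
lemma exists_linearMap [Finite V] [Fintype E] (hl : l ∈ Γ.metrics)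
    (hτ : Integrable l τ) (hp : Γ.IsPotential (N • l + (-1 : ℝ) • τ) p) (ht : 0 ≤ t)
    (hsmall : ∀ d, l d.1 ≠ 0 → 0 < (l + t • τ) d.1 ∧ 2 * (t * |p d|) ≤ (l + t • τ) d.1) :
    ∃ φ : Γ.LinearMap Γ, (∀ e, lengthPL (l + t • τ) (φ.edge e) ≤ (1 + t * N) * l e) ∧
      ∀ {n : ℕ} (f : Γ.Marking n), φ.IsDifference f f := by
  obtain ⟨δ, s, K, hr, hK, hδ⟩ := exists_roots hl hτ hp
  let θ : V → unitInterval := fun v => rootParam l τ t (δ v) (s v)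
  have hθ := fun v => rootParam_spec (hr v) ht (hsmall (δ v))
  let x : V → Γ.Pt := fun v => Γ.dartPos (δ v) (θ v)
  let q : V → List (EdgeSeg E) := fun v => (K v).flatMap dartPL ++ [dartSeg (δ v) 0 (θ v)]
  have hend : ∀ v, Γ.IsPLPath (Sum.inl (Γ.src (δ v))) (x v) [dartSeg (δ v) 0 (θ v)] := fun v => by
    rw [← dartPos_zero]; exact isPLPath_dartSeg _ _ _
  have hq : ∀ v, Γ.IsPLPath (Sum.inl v) (x v) (q v) := fun v =>
    (hK v).1.1.isPLPath.append (hend v)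
  have hedge : ∀ e, ∃ P, Γ.Homotopic (Sum.inl (Γ.init e)) (x (Γ.term e))
      (dartPL (e, true) ++ q (Γ.term e)) (q (Γ.init e) ++ P) ∧
      Γ.IsPLPath (x (Γ.init e)) (x (Γ.term e)) P ∧
      lengthPL (l + t • τ) P ≤ (1 + t * N) * l e := by
    intro e
    by_cases he : l e = 0
    · obtain ⟨h₁, h₂⟩ := hδ e he
      have hx : x (Γ.init e) = x (Γ.term e) := by simp only [x, θ, h₁, h₂]
      -- A zero edge is sent to a point. The required homotopy holds since paths in the zero forest
      -- are unique up to homotopy.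
      refine ⟨[], ?_, hx, by simp [lengthPL, he]⟩
      have h₃ : Γ.ZeroPath l (Γ.init e) (Γ.src (δ (Γ.term e))) ((e, true) :: K (Γ.term e)) :=
        ⟨⟨by simp [src], (hK _).1.1⟩, fun d hd => by
          rcases List.mem_cons.1 hd with rfl | hd
          exacts [he, (hK _).1.2 d hd]⟩
      have h₄ := (hK (Γ.init e)).1
      rw [h₁] at h₄
      have h₅ := (h₃.1.homotopic_of_mk_eq h₄.1 (h₃.mk_eq hl h₄)).append_right (hend _)
      have h₆ : dartSeg (δ (Γ.init e)) 0 (θ (Γ.init e)) =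
          dartSeg (δ (Γ.term e)) 0 (θ (Γ.term e)) := by simp only [θ, h₁, h₂]
      simp only [q, h₆]
      simpa using h₅
    · obtain ⟨η₁, Q₁, a₁, a₂, a₃⟩ := exists_track (e := (e, true)) hp ht (hr (Γ.init e))
        (hK (Γ.init e)).1 (hK _).2 he (hθ _).1 (hθ _).2
      obtain ⟨η₂, Q₂, b₁, b₂, b₃⟩ := exists_track (e := rev (e, true)) hp ht (hr (Γ.term e))
        (hK (Γ.term e)).1 (hK _).2 he (hθ _).1 (hθ _).2
      change Γ.Homotopic (Sum.inl (Γ.init e)) (x (Γ.init e)) (q (Γ.init e)) _ at a₂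
      change Γ.Homotopic (Sum.inl (Γ.term e)) (x (Γ.term e)) (q (Γ.term e)) _ at b₂
      rw [dartSeg_rev, unitInterval.symm_zero] at b₂
      set d : E × Bool := (e, true) with hd
      set η₃ := unitInterval.symm η₂ with hη₃
      have hQ₁ : Γ.IsPLPath (Γ.dartPos d η₁) (x (Γ.init e)) Q₁ := a₂.2.1.2
      have hQ₂ : Γ.IsPLPath (Γ.dartPos d η₃) (x (Γ.term e)) Q₂ := b₂.2.1.2
      have hmid := isPLPath_dartSeg (Γ := Γ) d η₁ η₃
      have hP := (hQ₁.reverse.append hmid).append hQ₂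
      have hs : Γ.dartPos d 0 = Sum.inl (Γ.init e) := dartPos_zero d
      have ht' : Γ.dartPos d 1 = Sum.inl (Γ.term e) := dartPos_one d
      -- Go back along the track of the initial vertex, cross what remains of the edge, and follow
      -- the track of the terminal vertex. As `η₁, η₂ ≤ 1 / 2`, the middle piece has the fraction `1
      -- - η₁ - η₂` of the edge.
      refine ⟨reversePL Q₁ ++ [dartSeg d η₁ η₃] ++ Q₂, ?_, hP, ?_⟩
      · have c₁ := b₂.append_left (x := Sum.inl (Γ.init e)) (L := dartPL d) (by
          rw [dartPL_eq, ← hs, ← ht']; exact isPLPath_dartSeg d 0 1)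
        have c₂ := (homotopic_dartSeg (Γ := Γ) d 0 1 η₃).append_right hQ₂
        have c₃ := (homotopic_dartSeg (Γ := Γ) d 0 η₁ η₃).append_right hQ₂
        have c₄ := hQ₁.homotopic_cancel.append (isPLPath_dartSeg d 0 η₁) (hmid.append hQ₂)
        have c₅ := a₂.append_right hP
        rw [hs] at c₂ c₃ c₄
        simp only [dartPL_eq, List.append_assoc, List.cons_append, List.nil_append] at c₁ c₂ c₃ c₄ c₅ ⊢
        exact c₁.trans (c₂.trans (c₃.symm.trans (c₄.symm.trans c₅.symm)))
      · rw [lengthPL_append, lengthPL_append, lengthPL_reversePL, lengthPL_dartSeg]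
        have e₁ : |(η₃ : ℝ) - η₁| = 1 - η₂ - η₁ := by
          rw [hη₃, unitInterval.coe_symm_eq, abs_of_nonneg]
          linarith
        have e₂ := hp.edge d
        simp only [Pi.add_apply, Pi.smul_apply, smul_eq_mul, rev_fst, hd] at e₁ e₂ a₃ b₃ ⊢
        rw [e₁]
        -- The two tracks cost at most `t (p d + p (rev d)) = t (Nℓ - τ)`, which cancels the change
        -- `tτ` of the edge length.
        have e₃ := congrArg (t * ·) e₂
        linarith
  choose P hP₁ hP₂ hP₃ using hedge
  let φ : Γ.LinearMap Γ := ⟨x, P, hP₂⟩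
  refine ⟨φ, hP₃, fun f => ⟨q f.base, hq _, fun i => ?_⟩⟩
  have hdart : ∀ d : E × Bool, Γ.IsPLPath (x (Γ.src d)) (x (Γ.tgt d)) (φ.mapPath [d]) ∧
      Γ.Homotopic (Sum.inl (Γ.src d)) (x (Γ.tgt d)) (dartPL d ++ q (Γ.tgt d))
        (q (Γ.src d) ++ φ.mapPath [d]) := by
    rintro ⟨e, b⟩
    cases b with
    | true => exact ⟨by simpa [LinearMap.mapPath, src, tgt] using hP₂ e,
        by simpa [LinearMap.mapPath, src, tgt] using hP₁ e⟩
    | false =>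
      have hrev := (hP₂ e).reverse
      have h₀ : φ.mapPath [(e, false)] = reversePL (P e) := by simp [LinearMap.mapPath, φ]
      rw [h₀]
      refine ⟨hrev, ?_⟩
      have hd : Γ.IsPLPath (Sum.inl (Γ.term e)) (Sum.inl (Γ.init e)) (dartPL (e, false)) :=
        isPLPath_dartPL (e, false)
      have hd' : dartPL (e, true) = reversePL (dartPL (e, false)) := by simp [dartPL, reversePL]
      have c₁ := (hP₂ e).homotopic_cancel.append_left (hd.append (hq _))
      have c₂ := (hP₁ e).append hd hrev
      have c₃ := hd.homotopic_cancel.append_right ((hq (Γ.term e)).append hrev)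
      rw [← hd'] at c₃
      simp only [List.append_assoc, List.nil_append, List.append_nil] at c₁ c₂ c₃
      exact c₁.symm.trans (c₂.symm.trans c₃)
  have key : ∀ (α : List (E × Bool)) u v, Γ.IsPath u v α →
      Γ.Homotopic (Sum.inl u) (x v) (α.flatMap dartPL ++ q v) (q u ++ φ.mapPath α) ∧
        Γ.IsPLPath (x u) (x v) (φ.mapPath α) := by
    intro α
    induction α with
    | nil =>
      rintro u v rfl
      exact ⟨by simpa [LinearMap.mapPath] using Homotopic.refl (hq u), rfl⟩
    | cons d α ih =>
      rintro u v ⟨rfl, h⟩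
      obtain ⟨h₁, h₂⟩ := ih _ _ h
      obtain ⟨h₃, h₄⟩ := hdart d
      have h₅ : φ.mapPath (d :: α) = φ.mapPath [d] ++ φ.mapPath α := by simp [LinearMap.mapPath]
      rw [h₅]
      refine ⟨?_, h₃.append h₂⟩
      have c₁ := h₁.append_left (isPLPath_dartPL d)
      have c₂ := h₄.append_right h₂
      simp only [List.flatMap_cons, List.append_assoc] at c₁ c₂ ⊢
      exact c₁.trans c₂
  exact (key _ _ _ (f.petal_isPath i)).1

lemma lengthPL_nonneg (hl : ∀ e, 0 ≤ l e) (P : List (EdgeSeg E)) : 0 ≤ lengthPL l P := by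
  refine List.sum_nonneg fun r hr => ?_
  obtain ⟨x, -, rfl⟩ := List.mem_map.1 hr
  exact mul_nonneg (abs_nonneg _) (hl _)

/-- For small `t` the Lipschitz distance is the logarithm of `1 + t‖τ‖`. -/
lemma lipDist_eq [Finite V] [Fintype E] [Nonempty E] {n : ℕ} (f : Γ.Marking n) (hl : l ∈ Γ.metrics)
    (hτ' : τ ∈ Γ.tangent) (hτ : Integrable l τ)
    (hp : Γ.IsPotential (Γ.normL l τ • l + (-1 : ℝ) • τ) p) (ht : 0 ≤ t)
    (hsmall : ∀ d, l d.1 ≠ 0 → 0 < (l + t • τ) d.1 ∧ 2 * (t * |p d|) ≤ (l + t • τ) d.1) :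
    lipDist f l f (l + t • τ) = Real.log (1 + t * Γ.normL l τ) := by
  have hN := normL_nonneg hl hτ'
  have hpos : 0 < 1 + t * Γ.normL l τ := by positivity
  have hl₀ : ∀ e, 0 ≤ l e := fun e => (hl.1 e).1
  have hl' : ∀ e, 0 ≤ (l + t • τ) e := fun e => by
    by_cases h0 : l e = 0
    · have : 0 ≤ τ e := by
        by_contra! h
        exact (hτ e h).ne' h0
      simp only [Pi.add_apply, Pi.smul_apply, smul_eq_mul, h0, zero_add]
      positivity
    · exact (hsmall (e, true) h0).1.le
  -- A loop attaining the norm has length exactly `(1 + t‖τ‖)ℓ(α)` in the target metric.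
  have hlow : ∀ φ : Γ.LinearMap Γ, φ.IsDifference f f → φ.Descends l (l + t • τ) →
      1 + t * Γ.normL l τ ≤ φ.slope l (l + t • τ) := fun φ h hd => by
    obtain ⟨α, hα, h₁⟩ := exists_normL_eq hl τ
    have h₂ := h.le_slope_mul hd hl₀ hl' hα
    rw [pathWeight_add, pathWeight_smul, h₁] at h₂
    refine le_of_mul_le_mul_right (le_trans (le_of_eq ?_) h₂) (hα.length_pos hl)
    ring
  obtain ⟨φ, h₁, h₂⟩ := exists_linearMap hl hτ hp ht hsmall
  have hd : φ.Descends l (l + t • τ) := fun e he =>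
    le_antisymm (by simpa [he] using h₁ e) (lengthPL_nonneg hl' _)
  have hslope : φ.slope l (l + t • τ) = 1 + t * Γ.normL l τ := by
    refine le_antisymm (ciSup_le fun e => ?_) (hlow φ (h₂ f) hd)
    rcases (hl₀ e).eq_or_lt with h0 | h0
    · rw [← h0, div_zero]; exact hpos.le
    · exact (div_le_iff₀ h0).2 (h₁ e)
  refine IsLeast.csInf_eq ⟨⟨φ, h₂ f, hd, by rw [hslope]⟩, ?_⟩
  rintro r ⟨ψ, hψ, hψd, rfl⟩
  exact Real.log_le_log hpos (hlow ψ hψ hψd)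

lemma tendsto_log_div (N : ℝ) :
    Tendsto (fun t : ℝ => Real.log (1 + t * N) / t) (𝓝[>] 0) (𝓝 N) := by
  have h : HasDerivAt (fun t : ℝ => Real.log (1 + t * N)) N 0 := by
    have h₁ : HasDerivAt (fun t : ℝ => 1 + t * N) N 0 := by
      simpa using ((hasDerivAt_id (0 : ℝ)).mul_const N).const_add 1
    simpa using h₁.log (by simp)
  have h₂ := h.tendsto_slope_zero_right
  refine h₂.congr fun t => ?_
  simp [div_eq_inv_mul]

lemma tendsto_lipDist_div [Finite V] [Fintype E] [Nonempty E] {n : ℕ} (f : Γ.Marking n)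
    (hl : l ∈ Γ.metrics) (hτ' : τ ∈ Γ.tangent) (hτ : Integrable l τ) :
    Tendsto (fun t : ℝ => lipDist f l f (l + t • τ) / t) (𝓝[>] 0) (𝓝 (Γ.normL l τ)) := by
  obtain ⟨p, hp⟩ := exists_potential_normL hl τ
  refine (tendsto_log_div _).congr' ?_
  have hsmall : ∀ᶠ t : ℝ in 𝓝[>] 0, ∀ d : E × Bool, l d.1 ≠ 0 →
      0 < (l + t • τ) d.1 ∧ 2 * (t * |p d|) ≤ (l + t • τ) d.1 := by
    refine eventually_all.2 fun d => ?_
    by_cases h0 : l d.1 = 0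
    · exact .of_forall fun t h => absurd h0 h
    have hpos : 0 < l d.1 := lt_of_le_of_ne (hl.1 d.1).1 (Ne.symm h0)
    have h₁ : Tendsto (fun t : ℝ => l d.1 + t * τ d.1) (𝓝[>] 0) (𝓝 (l d.1 + 0 * τ d.1)) :=
      (Continuous.tendsto (by fun_prop) 0).mono_left nhdsWithin_le_nhds
    have h₂ : Tendsto (fun t : ℝ => l d.1 + t * τ d.1 - 2 * (t * |p d|)) (𝓝[>] 0)
        (𝓝 (l d.1 + 0 * τ d.1 - 2 * (0 * |p d|))) :=
      (Continuous.tendsto (by fun_prop) 0).mono_left nhdsWithin_le_nhds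
    filter_upwards [h₁.eventually (lt_mem_nhds (a := 0) (by simpa)),
      h₂.eventually (lt_mem_nhds (a := 0) (by simpa))] with t h₃ h₄ _
    exact ⟨by simpa using h₃, by simpa using (sub_pos.1 h₄).le⟩
  filter_upwards [hsmall, self_mem_nhdsWithin] with t h ht
  rw [lipDist_eq f hl hτ' hτ hp (le_of_lt ht) h]

end

end TopGraph

theorem mainTheorem6 {V E : Type*} [Finite V] [Fintype E] {n : ℕ}
    (Γ : TopGraph V E) (f : Γ.Marking n) :
    -- (1) for integrable vectors the norm is the right derivative at 0 of the distance
    (∀ l ∈ Γ.metrics, ∀ τ ∈ Γ.tangent, TopGraph.Integrable l τ →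
      Tendsto (fun t : ℝ => TopGraph.lipDist f l f (l + t • τ) / t) (𝓝[>] 0)
        (𝓝 (Γ.normL l τ))) ∧
    -- (2) the supremum in the definition of the norm is achieved on a candidate loop
    (∀ l ∈ Γ.metrics, ∀ τ ∈ Γ.tangent, ∃ α, Γ.IsCandidate α ∧ Γ.IsLoop α ∧
      Γ.normL l τ = TopGraph.weight τ α / TopGraph.weight l α ∧
      ∀ β, Γ.IsLoop β →
        TopGraph.weight τ β / TopGraph.weight l β ≤ TopGraph.weight τ α / TopGraph.weight l α) ∧
    -- (3) continuity on the total tangent space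
    ContinuousOn (fun p : (E → ℝ) × (E → ℝ) => Γ.normL p.1 p.2) (Γ.metrics ×ˢ Γ.tangent) ∧
    -- (4) positivity
    (∀ l ∈ Γ.metrics, ∀ τ ∈ Γ.tangent, 0 ≤ Γ.normL l τ ∧ (Γ.normL l τ = 0 → τ = 0)) ∧
    -- (5) subadditivity
    (∀ l ∈ Γ.metrics, ∀ τ₁ ∈ Γ.tangent, ∀ τ₂ ∈ Γ.tangent,
      Γ.normL l (τ₁ + τ₂) ≤ Γ.normL l τ₁ + Γ.normL l τ₂) ∧
    -- (6) positive homogeneity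
    (∀ l ∈ Γ.metrics, ∀ τ ∈ Γ.tangent, ∀ c : ℝ, 0 < c →
      Γ.normL l (c • τ) = c * Γ.normL l τ) := by
  -- The marking supplies a vertex, and the valence condition an edge at it.
  have : Nonempty E := by
    obtain ⟨d, -⟩ := Γ.exists_src_eq f.base
    exact ⟨d.1⟩
  refine ⟨fun l hl τ hτ hi => TopGraph.tendsto_lipDist_div f hl hτ hi, fun l hl τ _ => ?_,
    Γ.continuousOn_normL,
    fun l hl τ hτ => ⟨TopGraph.normL_nonneg hl hτ,
      fun h => TopGraph.eq_zero_of_normL_nonpos hl hτ h.le⟩,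
    fun l hl τ₁ _ τ₂ _ => TopGraph.normL_add_le hl τ₁ τ₂,
    fun l hl τ _ c hc => TopGraph.normL_smul hl τ hc⟩
  obtain ⟨α, hc, hα, h⟩ := TopGraph.exists_candidate_normL hl τ
  have h' : Γ.normL l τ = TopGraph.weight τ α / TopGraph.weight l α := by
    rw [hα.weight_eq, hα.weight_eq, h, mul_div_cancel_right₀ _ (hα.length_pos hl).ne']
  refine ⟨α, hc, hα.isLoop, h', fun β hβ => ?_⟩
  rw [← h', TopGraph.weight_eq, TopGraph.weight_eq,
    div_le_iff₀ (hβ.immersed_tighten.length_pos hl)]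
  exact TopGraph.pathWeight_le_normL hl τ hβ.immersed_tighten
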